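/- For $n\ge 2$ let $\mathbb{C}_{\mathrm{SST}}$ be the set of matrices $M\in[0,1]^{n\times n}$ such that $M_{ji}=1-M_{ij}$ for all $i,j\in[n]$ and such that, for some permutation $\pi$ of $[n]$, $\pi(i)<\pi(j)$ implies $M_{ik}\ge M_{jk}$ for all $k\in[n]$. For $M^*\in\mathbb{C}_{\mathrm{SST}}$, an observation from $M^*$ is a random matrix $Y\in\{0,1\}^{n\times n}$ whose entries $Y_{ij}$, $i\le j$, are independent with $\mathbb{P}[Y_{ij}=1]=M^*_{ij}$, and with $Y_{ji}=1-Y_{ij}$ for $i<j$. For $\lambda>0$ and a singular value decomposition $Y=UDV^T$ with $U,V$ orthogonal and $D$ diagonal with nonnegative entries, let $T_\lambda(Y)=U\,T_\lambda(D)\,V^T$, where $T_\lambda(D)$ is the diagonal matrix with entries $[T_\lambda(D)]_{jj}=\max\{0,D_{jj}-\lambda\}$ (the matrix $T_\lambda(Y)$ does not depend on the choice of the decomposition). Let $\|\cdot\|_F$ be the Frobenius norm. **Theorem.** (a) There are universal positive constants $c_u,c_0,c_1$ such that for every $n\ge2$, every $M^*\in\mathbb{C}_{\mathrm{SST}}$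 and every observation $Y$ from $M^*$, with $\lambda=2.1\sqrt n$, $$\mathbb{P}\Big[\frac1{n^2}\|T_\lambda(Y)-M^*\|_F^2\ge\frac{c_u}{\sqrt n}\Big]\le c_0e^{-c_1n}.$$ (b) There is a universal constant $c_\ell>0$ such that for every $n\ge2$ and every $\lambda>0$ there is a matrix $M^*\in\mathbb{C}_{\mathrm{SST}}$, depending only on $n$ and $\lambda$, such that every observation $Y$ from $M^*$ satisfies, with probability one, $$\frac1{n^2}\|T_\lambda(Y)-M^*\|_F^2\ge\frac{c_\ell}{\sqrt n}.$$ -/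

import Mathlib

open MeasureTheory ProbabilityTheory
open scoped Matrix

namespace PairwiseComparison

/-- `M` is `π`-faithful: `π i < π j` implies `M i k ≥ M j k` for every `k`. -/
def IsFaithful {n : ℕ} (π : Equiv.Perm (Fin n)) (M : Matrix (Fin n) (Fin n) ℝ) : Prop :=
  ∀ i j, π i < π j → ∀ k, M j k ≤ M i k

/-- The class of strongly stochastically transitive (SST) matrices on `n` items. -/
def SST (n : ℕ) : Set (Matrix (Fin n) (Fin n) ℝ) :=
  {M | (∀ i j, M i j ∈ Set.Icc (0 : ℝ) 1) ∧ (∀ i j, M j i = 1 - M i j) ∧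
    ∃ π : Equiv.Perm (Fin n), IsFaithful π M}

/-- The random matrix `Y` is an observation with comparison probabilities `M`: it is
`{0, 1}`-valued, its entries on and above the diagonal are independent Bernoulli variables with
success probabilities `M i j`, and the entries below the diagonal are `Y j i = 1 - Y i j`. -/
structure IsObservation {n : ℕ} {Ω : Type*} [MeasurableSpace Ω]
    (M : Matrix (Fin n) (Fin n) ℝ) (Y : Ω → Matrix (Fin n) (Fin n) ℝ) (μ : Measure Ω) : Prop where
  measurable : ∀ i j, Measurable fun ω => Y ω i j
  zero_or_one : ∀ ω i j, Y ω i j = 0 ∨ Y ω i j = 1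
  prob_eq : ∀ i j, i ≤ j → μ.real {ω | Y ω i j = 1} = M i j
  indep : iIndepFun (fun (p : {p : Fin n × Fin n // p.1 ≤ p.2}) ω => Y ω p.1.1 p.1.2) μ
  skew : ∀ ω i j, i < j → Y ω j i = 1 - Y ω i j

/-- `Y = U D Vᵀ` is a singular value decomposition of `Y`, where `D` is the diagonal matrix with
the nonnegative diagonal `d`. -/
structure IsSVD {n : ℕ} (Y U : Matrix (Fin n) (Fin n) ℝ) (d : Fin n → ℝ)
    (V : Matrix (Fin n) (Fin n) ℝ) : Prop where
  left_orthogonal : U ∈ Matrix.orthogonalGroup (Fin n) ℝ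
  right_orthogonal : V ∈ Matrix.orthogonalGroup (Fin n) ℝ
  nonneg : ∀ j, 0 ≤ d j
  eq_mul : Y = U * Matrix.diagonal d * Vᵀ

theorem exists_isSVD {n : ℕ} (Y : Matrix (Fin n) (Fin n) ℝ) : ∃ U d V, IsSVD Y U d V := by
  have hH : (Yᵀ * Y).IsHermitian := by
    simpa using Matrix.isHermitian_conjTranspose_mul_self Y
  have hP : (Yᵀ * Y).PosSemidef := by
    simpa using Matrix.posSemidef_conjTranspose_mul_self Y
  obtain ⟨V, e, hV, he, hVe⟩ : ∃ (V : Matrix (Fin n) (Fin n) ℝ) (e : Fin n → ℝ),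
      V ∈ Matrix.orthogonalGroup (Fin n) ℝ ∧ (∀ j, 0 ≤ e j) ∧
        Yᵀ * Y = V * Matrix.diagonal e * Vᵀ := by
    refine ⟨hH.eigenvectorUnitary, hH.eigenvalues, SetLike.coe_mem _, hP.eigenvalues_nonneg, ?_⟩
    have h := hH.spectral_theorem
    rw [Unitary.conjStarAlgAut_apply] at h
    exact h
  have hVV : Vᵀ * V = 1 := (Matrix.mem_orthogonalGroup_iff' _ _).1 hV
  have hVV' : V * Vᵀ = 1 := (Matrix.mem_orthogonalGroup_iff _ _).1 hV
  set B := Y * V with hB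
  have hBB : Bᵀ * B = Matrix.diagonal e := by
    rw [hB, Matrix.transpose_mul, Matrix.mul_assoc, ← Matrix.mul_assoc Yᵀ, hVe]
    simp only [Matrix.mul_assoc, hVV, Matrix.mul_one]
    rw [← Matrix.mul_assoc, hVV, Matrix.one_mul]
  have hent : ∀ i j, ∑ k, B k i * B k j = if i = j then e i else 0 := by
    intro i j
    have := congrFun (congrFun hBB i) j
    simpa [Matrix.mul_apply, Matrix.diagonal_apply] using this
  set d : Fin n → ℝ := fun j => √(e j) with hd
  set v : Fin n → EuclideanSpace ℝ (Fin n) := fun j => WithLp.toLp 2 fun i => (d j)⁻¹ * B i j with hv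
  set s : Set (Fin n) := {j | d j ≠ 0} with hs
  have hdd : ∀ j, d j * d j = e j := fun j => Real.mul_self_sqrt (he j)
  have hor : Orthonormal ℝ (s.domRestrict v) := by
    rw [orthonormal_iff_ite]
    rintro ⟨i, hi⟩ ⟨j, hj⟩
    have h1 : inner ℝ (v i) (v j) = (d i)⁻¹ * (d j)⁻¹ * ∑ k, B k i * B k j := by
      simp only [PiLp.inner_apply, hv, Finset.mul_sum]
      refine Finset.sum_congr rfl fun k _ => ?_
      simp
      ring
    simp only [Set.domRestrict_apply, Subtype.mk.injEq]
    rw [h1, hent]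
    by_cases hij : i = j
    · subst hij
      have : d i ≠ 0 := hi
      simp only [if_true]
      rw [← hdd i]
      field_simp
    · simp [hij]
  obtain ⟨b, hb⟩ := hor.exists_orthonormalBasis_extension_of_card_eq (by simp)
  set U : Matrix (Fin n) (Fin n) ℝ := Matrix.of fun i j => b j i with hU
  have hUD : U * Matrix.diagonal d = B := by
    ext i j
    rw [Matrix.mul_diagonal]
    by_cases hj : d j = 0
    · have h0 : ∑ k, B k j * B k j = 0 := by
        rw [hent, if_pos rfl, ← hdd j, hj, mul_zero]
      have := (Finset.sum_eq_zero_iff_of_nonneg fun k _ => mul_self_nonneg (B k j)).1 h0 i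
        (Finset.mem_univ i)
      rw [hj, mul_zero, mul_self_eq_zero.1 this]
    · have h1 : U i j = (d j)⁻¹ * B i j := by
        simp only [hU, Matrix.of_apply, hb j hj, hv]
      rw [h1]
      field_simp
  refine ⟨U, d, V, ?_, hV, fun j => Real.sqrt_nonneg _, ?_⟩
  · rw [Matrix.mem_orthogonalGroup_iff']
    ext i j
    have h := orthonormal_iff_ite.1 b.orthonormal i j
    rw [Matrix.mul_apply, Matrix.one_apply, ← h, PiLp.inner_apply]
    refine Finset.sum_congr rfl fun k _ => ?_
    simp [hU, mul_comm]
  · rw [hUD, hB, Matrix.mul_assoc, hVV', Matrix.mul_one]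

/-- Soft thresholding at level `t` of the diagonal of a diagonal matrix. -/
noncomputable def softThreshold {n : ℕ} (t : ℝ) (d : Fin n → ℝ) : Fin n → ℝ :=
  fun j => max 0 (d j - t)

/-- The soft singular-value-thresholded version `U T(D) Vᵀ` of `Y = U D Vᵀ` at level `t`. For
`0 ≤ t` it does not depend on the singular value decomposition used, see `softSVT_eq`. -/
noncomputable def softSVT {n : ℕ} (t : ℝ) (Y : Matrix (Fin n) (Fin n) ℝ) :
    Matrix (Fin n) (Fin n) ℝ :=
  (exists_isSVD Y).choose *
    Matrix.diagonal (softThreshold t (exists_isSVD Y).choose_spec.choose) *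
      ((exists_isSVD Y).choose_spec.choose_spec.choose)ᵀ

theorem IsSVD.mul_aeval {n : ℕ} {Y U V : Matrix (Fin n) (Fin n) ℝ} {d : Fin n → ℝ}
    (h : IsSVD Y U d V) (q : Polynomial ℝ) :
    Y * Polynomial.aeval (Yᵀ * Y) q =
      U * Matrix.diagonal (fun j => d j * q.eval (d j ^ 2)) * Vᵀ := by
  have hU : Uᵀ * U = 1 := (Matrix.mem_orthogonalGroup_iff' _ _).1 h.left_orthogonal
  have hV : Vᵀ * V = 1 := (Matrix.mem_orthogonalGroup_iff' _ _).1 h.right_orthogonal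
  have hV' : V * Vᵀ = 1 := (Matrix.mem_orthogonalGroup_iff _ _).1 h.right_orthogonal
  have hYY : Yᵀ * Y = V * Matrix.diagonal (fun j => d j ^ 2) * Vᵀ := by
    rw [h.eq_mul]
    simp only [Matrix.transpose_mul, Matrix.transpose_transpose, Matrix.diagonal_transpose,
      Matrix.mul_assoc]
    rw [← Matrix.mul_assoc Uᵀ, hU, Matrix.one_mul, ← Matrix.mul_assoc (Matrix.diagonal d),
      Matrix.diagonal_mul_diagonal]
    simp only [sq]
  have hq : Polynomial.aeval (Yᵀ * Y) q =
      V * Matrix.diagonal (fun j => q.eval (d j ^ 2)) * Vᵀ := by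
    induction q using Polynomial.induction_on' with
    | add p q hp hq =>
      rw [map_add, hp, hq, ← Matrix.add_mul, ← Matrix.mul_add, Matrix.diagonal_add]
      simp only [Polynomial.eval_add]
    | monomial k a =>
      have hpow : (Yᵀ * Y) ^ k = V * Matrix.diagonal (fun j => (d j ^ 2) ^ k) * Vᵀ := by
        induction k with
        | zero => simp [hV']
        | succ k ih =>
          rw [pow_succ, ih, hYY]
          simp only [Matrix.mul_assoc]
          rw [← Matrix.mul_assoc Vᵀ V, hV, Matrix.one_mul,
            ← Matrix.mul_assoc (Matrix.diagonal _) (Matrix.diagonal _),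
            Matrix.diagonal_mul_diagonal]
          simp only [pow_succ]
      rw [Polynomial.aeval_monomial, hpow, ← Algebra.smul_def, ← Matrix.smul_mul,
        ← Matrix.mul_smul, ← Matrix.diagonal_smul]
      congr 3
      ext j
      simp
  rw [hq]
  conv_lhs => rw [h.eq_mul]
  simp only [Matrix.mul_assoc]
  rw [← Matrix.mul_assoc Vᵀ V, hV, Matrix.one_mul,
    ← Matrix.mul_assoc (Matrix.diagonal _) (Matrix.diagonal _), Matrix.diagonal_mul_diagonal]

/-- Soft singular value thresholding can be computed from any singular value decomposition. -/
theorem softSVT_eq {n : ℕ} {t : ℝ} (ht : 0 ≤ t) {Y U V : Matrix (Fin n) (Fin n) ℝ}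
    {d : Fin n → ℝ} (h : IsSVD Y U d V) :
    softSVT t Y = U * Matrix.diagonal (softThreshold t d) * Vᵀ := by
  have h' := (exists_isSVD Y).choose_spec.choose_spec.choose_spec
  unfold softSVT
  set U' := (exists_isSVD Y).choose
  set d' := (exists_isSVD Y).choose_spec.choose
  set V' := (exists_isSVD Y).choose_spec.choose_spec.choose
  classical
  set S : Finset ℝ := (Finset.univ.image fun j => d j ^ 2) ∪ (Finset.univ.image fun j => d' j ^ 2)
  set q : Polynomial ℝ := Lagrange.interpolate S id fun x => max 0 (√x - t) / √x
  have hq : ∀ x ∈ S, q.eval x = max 0 (√x - t) / √x := fun x hx =>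
    Lagrange.eval_interpolate_at_node (v := id) _ (Set.injOn_id _) hx
  have hval : ∀ a : ℝ, 0 ≤ a → a ^ 2 ∈ S → a * q.eval (a ^ 2) = max 0 (a - t) := by
    intro a ha haS
    rw [hq _ haS, Real.sqrt_sq ha]
    rcases ha.eq_or_lt with rfl | ha
    · simp [ht]
    · field_simp
  have h1 : (fun j => d j * q.eval (d j ^ 2)) = softThreshold t d := by
    ext j
    exact hval _ (h.nonneg j) (by simp [S])
  have h2 : (fun j => d' j * q.eval (d' j ^ 2)) = softThreshold t d' := by
    ext j
    exact hval _ (h'.nonneg j) (by simp [S])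
  have e1 := h.mul_aeval q
  have e2 := h'.mul_aeval q
  rw [h1] at e1
  rw [h2] at e2
  rw [← e1, ← e2]

section

open scoped Matrix.Norms.Frobenius

/-- The normalized squared Frobenius error `‖A - M‖² / n²`. -/
noncomputable def normalizedError {n : ℕ} (A M : Matrix (Fin n) (Fin n) ℝ) : ℝ :=
  1 / (n : ℝ) ^ 2 * ‖A - M‖ ^ 2

end

end PairwiseComparison

/-! Upper bound. Two facts are combined. Off the diagonal the noise `Y - M` is skew, so its bilinear
form at a pair of unit vectors is a sum of independent terms with variance proxy at most 1/4; a
union bound over a net keeps its operator norm below `2 √n + 1/2`, hence below `2.05 √n` for large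
`n` (`IsObservation.measure_norm_gt_le`). The rows of an SST matrix are totally ordered pointwise,
so rows with nearby sums are close, and binning by row sum gives an approximation of rank at most `2
√n` with squared error at most `n √n` (`SST.exists_approx`). The deterministic oracle inequality
`frobSq_softSVT_sub_le` turns these into a total squared error of order `n √n`.

Lower bound. A threshold below a multiple of `√n` leaves `T` near `Y`, which lies at distance
exactly `n / 2` from the constant matrix 1/2. A larger threshold destroys signal. If `M` is the
noiseless total order, then `Y` is almost surely triangular up to its diagonal and acts as a
discrete integration operator; test vectors built from tent functions show that it has about `√n /
4` singular values of size at least about `√n / 4` (`IsTotalOrder.le_card_singularValues`).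
Thresholding changes each of them by that amount, at a squared cost of order `n √n`, while `Y`
differs from `M` by only `n / 4`. For bounded `n` the constant matrix serves again, through the
shrinkage bias of the threshold. -/

namespace PairwiseComparison

/-! ### Nets of the unit sphere by volume comparison. -/

section Net

open Metric Module
open scoped ENNReal Function

variable {E : Type*} [NormedAddCommGroup E] [NormedSpace ℝ E] [FiniteDimensional ℝ E]

/-- A `1/3`-separated subset of the unit ball has at most `7 ^ dim` elements. -/
theorem card_le_seven_pow_of_separated (s : Finset E) (hs : ∀ c ∈ s, ‖c‖ ≤ 1)
    (h : ∀ c ∈ s, ∀ d ∈ s, c ≠ d → 1 / 3 ≤ ‖c - d‖) : s.card ≤ 7 ^ finrank ℝ E := by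
  borelize E
  let μ : Measure E := Measure.addHaar
  -- Balls of radius 1/6 about the points are disjoint and lie in the ball of radius 7/6; the base 7
  -- is the ratio of the radii.
  let δ : ℝ := (1 : ℝ) / 6
  let ρ : ℝ := (7 : ℝ) / 6
  have δpos : 0 < δ := by norm_num [δ]
  have ρpos : 0 < ρ := by norm_num [ρ]
  set A := ⋃ c ∈ s, ball (c : E) δ with hA
  have D : Set.Pairwise (s : Set E) (Disjoint on fun c => ball (c : E) δ) := by
    rintro c hc d hd hcd
    apply ball_disjoint_ball
    rw [dist_eq_norm]
    refine le_trans ?_ (h c hc d hd hcd)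
    norm_num [δ]
  have A_subset : A ⊆ ball (0 : E) ρ := by
    refine Set.iUnion₂_subset fun x hx => ?_
    apply ball_subset_ball'
    calc
      δ + dist x 0 ≤ δ + 1 := by rw [dist_zero_right]; exact add_le_add le_rfl (hs x hx)
      _ = 7 / 6 := by norm_num [δ]
  have I :
    (s.card : ℝ≥0∞) * ENNReal.ofReal (δ ^ finrank ℝ E) * μ (ball 0 1) ≤
      ENNReal.ofReal (ρ ^ finrank ℝ E) * μ (ball 0 1) :=
    calc
      (s.card : ℝ≥0∞) * ENNReal.ofReal (δ ^ finrank ℝ E) * μ (ball 0 1) = μ A := by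
        rw [hA, measure_biUnion_finset D fun c _ => measurableSet_ball]
        simp only [μ.addHaar_ball_of_pos _ δpos]
        simp only [Finset.sum_const, nsmul_eq_mul, mul_assoc]
      _ ≤ μ (ball (0 : E) ρ) := measure_mono A_subset
      _ = ENNReal.ofReal (ρ ^ finrank ℝ E) * μ (ball 0 1) := by
        simp only [μ.addHaar_ball_of_pos _ ρpos]
  have J : (s.card : ℝ≥0∞) * ENNReal.ofReal (δ ^ finrank ℝ E) ≤ ENNReal.ofReal (ρ ^ finrank ℝ E) :=
    (ENNReal.mul_le_mul_iff_left (measure_ball_pos _ _ zero_lt_one).ne' measure_ball_lt_top.ne).1 I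
  have K : (s.card : ℝ) * δ ^ finrank ℝ E ≤ ρ ^ finrank ℝ E := by
    have := ENNReal.toReal_le_of_le_ofReal (pow_nonneg ρpos.le _) J
    rwa [ENNReal.toReal_mul, ENNReal.toReal_natCast,
      ENNReal.toReal_ofReal (pow_nonneg δpos.le _)] at this
  have hρ : ρ = 7 * δ := by norm_num [ρ, δ]
  rw [hρ, mul_pow] at K
  have := le_of_mul_le_mul_right K (pow_pos δpos _)
  exact mod_cast this

/-- The unit sphere has a `1/3`-net with at most `7 ^ dim` elements. -/
theorem exists_net (E : Type*) [NormedAddCommGroup E] [NormedSpace ℝ E] [FiniteDimensional ℝ E] :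
    ∃ N : Finset E, N.card ≤ 7 ^ finrank ℝ E ∧ (∀ x ∈ N, ‖x‖ = 1) ∧
      ∀ u : E, ‖u‖ = 1 → ∃ x ∈ N, ‖x - u‖ ≤ 1 / 3 := by
  classical
  by_contra! hcon
  -- Greedy choice: if no separated set were a net, each could be enlarged, past the cardinality
  -- bound.
  have key : ∀ k : ℕ, ∃ s : Finset E, s.card = k ∧ (∀ x ∈ s, ‖x‖ = 1) ∧
      ∀ c ∈ s, ∀ d ∈ s, c ≠ d → 1 / 3 ≤ ‖c - d‖ := by
    intro k
    induction k with
    | zero => exact ⟨∅, by simp⟩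
    | succ k ih =>
      obtain ⟨s, hk, hs, hsep⟩ := ih
      obtain ⟨u, hu, hus⟩ := hcon s
        (card_le_seven_pow_of_separated s (fun c hc => (hs c hc).le) hsep) hs
      have hmem : u ∉ s := fun h => by
        have := hus u h
        rw [sub_self, norm_zero] at this
        linarith
      refine ⟨insert u s, by rw [Finset.card_insert_of_notMem hmem, hk], ?_, ?_⟩
      · intro x hx
        rcases Finset.mem_insert.1 hx with rfl | hx
        exacts [hu, hs x hx]
      · intro c hc d hd hcd
        rcases Finset.mem_insert.1 hc with rfl | hc' <;> rcases Finset.mem_insert.1 hd with rfl | hd'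
        · exact absurd rfl hcd
        · rw [norm_sub_rev]; exact (hus d hd').le
        · exact (hus c hc').le
        · exact hsep c hc' d hd' hcd
  obtain ⟨s, hk, hs, hsep⟩ := key (7 ^ finrank ℝ E + 1)
  have := card_le_seven_pow_of_separated s (fun c hc => (hs c hc).le) hsep
  omega

end Net

/-! ### Frobenius norms, singular value decompositions and subspaces. -/

section LinearAlgebra

open Matrix Module

variable {n : ℕ}

/-- The squared Frobenius norm of a matrix. -/
def frobSq (A : Matrix (Fin n) (Fin n) ℝ) : ℝ := ∑ i, ∑ j, A i j ^ 2

theorem frobSq_nonneg (A : Matrix (Fin n) (Fin n) ℝ) : 0 ≤ frobSq A :=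
  Finset.sum_nonneg fun _ _ => Finset.sum_nonneg fun _ _ => sq_nonneg _

theorem frobSq_eq_trace (A : Matrix (Fin n) (Fin n) ℝ) : frobSq A = (Aᵀ * A).trace := by
  simp only [frobSq, Matrix.trace, Matrix.diag, Matrix.mul_apply, Matrix.transpose_apply]
  rw [Finset.sum_comm]
  simp only [sq]

section

open scoped Matrix.Norms.Frobenius

theorem frobenius_norm_sq (A : Matrix (Fin n) (Fin n) ℝ) : ‖A‖ ^ 2 = frobSq A := by
  rw [Matrix.frobenius_norm_def, ← Real.sqrt_eq_rpow, Real.sq_sqrt]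
  · simp [frobSq]
  · exact Finset.sum_nonneg fun _ _ => Finset.sum_nonneg fun _ _ => by positivity

theorem normalizedError_eq (A M : Matrix (Fin n) (Fin n) ℝ) :
    normalizedError A M = frobSq (A - M) / (n : ℝ) ^ 2 := by
  rw [normalizedError, frobenius_norm_sq]
  ring

theorem sqrt_frobSq_triangle (A B C : Matrix (Fin n) (Fin n) ℝ) :
    √(frobSq (A - C)) ≤ √(frobSq (A - B)) + √(frobSq (B - C)) := by
  simp only [← frobenius_norm_sq, Real.sqrt_sq (norm_nonneg _)]
  exact norm_sub_le_norm_sub_add_norm_sub A B C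

theorem abs_trace_transpose_mul_le (A B : Matrix (Fin n) (Fin n) ℝ) :
    |(Aᵀ * B).trace| ≤ √(frobSq A) * √(frobSq B) := by
  have h : (Aᵀ * B).trace ^ 2 ≤ frobSq A * frobSq B := by
    have := Finset.sum_mul_sq_le_sq_mul_sq (Finset.univ : Finset (Fin n × Fin n))
      (fun p => A p.1 p.2) (fun p => B p.1 p.2)
    simp only [Fintype.sum_prod_type] at this
    simp only [frobSq, Matrix.trace, Matrix.diag, Matrix.mul_apply, Matrix.transpose_apply]
    rwa [Finset.sum_comm]
  rw [← Real.sqrt_mul (frobSq_nonneg A)]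
  exact Real.abs_le_sqrt h

end

theorem norm_toEuclideanLin_sq (A : Matrix (Fin n) (Fin n) ℝ) (x : EuclideanSpace ℝ (Fin n)) :
    ‖toEuclideanLin A x‖ ^ 2 = ∑ i, (∑ j, A i j * x j) ^ 2 := by
  rw [EuclideanSpace.real_norm_sq_eq]
  rfl

theorem norm_toEuclideanLin_orthogonal {U : Matrix (Fin n) (Fin n) ℝ}
    (hU : Uᵀ * U = 1) (x : EuclideanSpace ℝ (Fin n)) :
    ‖toEuclideanLin U x‖ = ‖x‖ := by
  have h : ‖toEuclideanLin U x‖ ^ 2 = ‖x‖ ^ 2 := by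
    rw [EuclideanSpace.real_norm_sq_eq, EuclideanSpace.real_norm_sq_eq]
    have h1 : ∀ y : Fin n → ℝ, ∑ i, y i ^ 2 = y ⬝ᵥ y := fun y => by simp [dotProduct, sq]
    rw [h1, h1, Matrix.toLpLin_apply, Matrix.dotProduct_mulVec, Matrix.vecMul_mulVec, hU,
      Matrix.vecMul_one]
  exact (sq_eq_sq₀ (norm_nonneg _) (norm_nonneg _)).1 h

theorem toEuclideanLin_mul (A B : Matrix (Fin n) (Fin n) ℝ) (x : EuclideanSpace ℝ (Fin n)) :
    toEuclideanLin (A * B) x = toEuclideanLin A (toEuclideanLin B x) := by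
  simp [Matrix.toLpLin_apply, Matrix.mulVec_mulVec]

/-- The norm of `U diag(e) Vᵀ x` in terms of the coordinates of `Vᵀ x`. -/
theorem norm_sq_orthogonal_diagonal {U V : Matrix (Fin n) (Fin n) ℝ} (hU : Uᵀ * U = 1)
    (e : Fin n → ℝ) (x : EuclideanSpace ℝ (Fin n)) :
    ‖toEuclideanLin (U * diagonal e * Vᵀ) x‖ ^ 2 =
      ∑ j, e j ^ 2 * toEuclideanLin Vᵀ x j ^ 2 := by
  rw [Matrix.mul_assoc, toEuclideanLin_mul, toEuclideanLin_mul, norm_toEuclideanLin_orthogonal hU,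
    EuclideanSpace.real_norm_sq_eq]
  simp only [Matrix.toLpLin_apply, Matrix.mulVec_diagonal, mul_pow]

theorem norm_sq_eq_sum_coord {V : Matrix (Fin n) (Fin n) ℝ} (hV : V * Vᵀ = 1)
    (x : EuclideanSpace ℝ (Fin n)) : ‖x‖ ^ 2 = ∑ j, toEuclideanLin Vᵀ x j ^ 2 := by
  rw [← norm_toEuclideanLin_orthogonal (U := Vᵀ) (by rwa [Matrix.transpose_transpose]) x,
    EuclideanSpace.real_norm_sq_eq]

/-- Only singular values at coordinates where `Vᵀ x` is nonzero are constrained, so the bound also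
applies on a span of selected right singular vectors. -/
theorem norm_orthogonal_diagonal_le {U V : Matrix (Fin n) (Fin n) ℝ} (hU : Uᵀ * U = 1)
    (hV : V * Vᵀ = 1) {e : Fin n → ℝ} {c : ℝ} (hc : 0 ≤ c) (x : EuclideanSpace ℝ (Fin n))
    (he : ∀ j, toEuclideanLin Vᵀ x j ≠ 0 → |e j| ≤ c) :
    ‖toEuclideanLin (U * diagonal e * Vᵀ) x‖ ≤ c * ‖x‖ := by
  refine le_of_sq_le_sq ?_ (by positivity)
  rw [norm_sq_orthogonal_diagonal hU, mul_pow, norm_sq_eq_sum_coord hV x, Finset.mul_sum]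
  refine Finset.sum_le_sum fun j _ => ?_
  by_cases h0 : toEuclideanLin Vᵀ x j = 0
  · simp [h0]
  · exact mul_le_mul_of_nonneg_right (sq_le_sq' (by linarith [neg_abs_le (e j), he j h0])
      ((le_abs_self _).trans (he j h0))) (sq_nonneg _)

theorem le_norm_orthogonal_diagonal {U V : Matrix (Fin n) (Fin n) ℝ} (hU : Uᵀ * U = 1)
    (hV : V * Vᵀ = 1) {e : Fin n → ℝ} {c : ℝ} (hc : 0 ≤ c) (x : EuclideanSpace ℝ (Fin n))
    (he : ∀ j, toEuclideanLin Vᵀ x j ≠ 0 → c ≤ e j) :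
    c * ‖x‖ ≤ ‖toEuclideanLin (U * diagonal e * Vᵀ) x‖ := by
  refine le_of_sq_le_sq ?_ (norm_nonneg _)
  rw [norm_sq_orthogonal_diagonal hU, mul_pow, norm_sq_eq_sum_coord hV x, Finset.mul_sum]
  refine Finset.sum_le_sum fun j _ => ?_
  by_cases h0 : toEuclideanLin Vᵀ x j = 0
  · simp [h0]
  · gcongr
    exact he j h0

theorem trace_orthogonal_diagonal {U V : Matrix (Fin n) (Fin n) ℝ} (hU : Uᵀ * U = 1)
    (hV : Vᵀ * V = 1) (e f : Fin n → ℝ) :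
    ((U * diagonal e * Vᵀ)ᵀ * (U * diagonal f * Vᵀ)).trace = ∑ j, e j * f j := by
  have : (U * diagonal e * Vᵀ)ᵀ * (U * diagonal f * Vᵀ) =
      V * (diagonal (fun j => e j * f j) * Vᵀ) := by
    simp only [Matrix.transpose_mul, Matrix.transpose_transpose, Matrix.diagonal_transpose,
      Matrix.mul_assoc]
    rw [← Matrix.mul_assoc Uᵀ, hU, Matrix.one_mul, ← Matrix.mul_assoc (diagonal e),
      Matrix.diagonal_mul_diagonal]
  rw [this, Matrix.trace_mul_comm, Matrix.mul_assoc, hV, Matrix.mul_one, Matrix.trace_diagonal]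

theorem frobSq_orthogonal_diagonal {U V : Matrix (Fin n) (Fin n) ℝ} (hU : Uᵀ * U = 1)
    (hV : Vᵀ * V = 1) (e : Fin n → ℝ) :
    frobSq (U * diagonal e * Vᵀ) = ∑ j, e j ^ 2 := by
  rw [frobSq_eq_trace, trace_orthogonal_diagonal hU hV]
  simp only [sq]

theorem sum_norm_sq_orthonormalBasis {ι : Type*} [Fintype ι]
    (b : OrthonormalBasis ι ℝ (EuclideanSpace ℝ (Fin n))) (A : Matrix (Fin n) (Fin n) ℝ) :
    ∑ k, ‖toEuclideanLin A (b k)‖ ^ 2 = frobSq A := by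
  simp only [norm_toEuclideanLin_sq]
  rw [Finset.sum_comm, frobSq]
  refine Finset.sum_congr rfl fun i _ => ?_
  have h := b.sum_sq_norm_inner_right (WithLp.toLp 2 (A i))
  rw [EuclideanSpace.real_norm_sq_eq] at h
  rw [← h]
  refine Finset.sum_congr rfl fun k _ => ?_
  rw [Real.norm_eq_abs, sq_abs, PiLp.inner_apply]
  simp

/-- An orthonormal basis of the ambient space that starts with one of the subspace `K`. -/
theorem exists_orthonormalBasis_adapted (K : Submodule ℝ (EuclideanSpace ℝ (Fin n))) :
    ∃ (b : OrthonormalBasis (Fin n) ℝ (EuclideanSpace ℝ (Fin n))) (s : Finset (Fin n)),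
      s.card = finrank ℝ K ∧ ∀ k ∈ s, b k ∈ K := by
  classical
  have hle : finrank ℝ K ≤ n := by simpa using K.finrank_le
  let c := stdOrthonormalBasis ℝ K
  let v : Fin n → EuclideanSpace ℝ (Fin n) := fun k =>
    if h : k.1 < finrank ℝ K then (c ⟨k.1, h⟩ : EuclideanSpace ℝ (Fin n)) else 0
  let s : Finset (Fin n) := Finset.univ.filter fun k => k.1 < finrank ℝ K
  have hv : Orthonormal ℝ ((s : Set (Fin n)).domRestrict v) := by
    rw [orthonormal_iff_ite]
    rintro ⟨i, hi⟩ ⟨j, hj⟩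
    have hi' : i.1 < finrank ℝ K := by simpa [s] using hi
    have hj' : j.1 < finrank ℝ K := by simpa [s] using hj
    have h := orthonormal_iff_ite.1 c.orthonormal ⟨i.1, hi'⟩ ⟨j.1, hj'⟩
    simp only [Set.domRestrict_apply, v, dif_pos hi', dif_pos hj', Subtype.mk.injEq]
    rw [← Submodule.coe_inner, h]
    simp [Fin.ext_iff]
  obtain ⟨b, hb⟩ := hv.exists_orthonormalBasis_extension_of_card_eq (by simp)
  refine ⟨b, s, ?_, fun k hk => ?_⟩
  · have : s.card = (Finset.univ : Finset (Fin (finrank ℝ K))).card := by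
      symm
      refine Finset.card_bij (fun k _ => Fin.castLE hle k) (fun k _ => by simp [s])
        (fun a _ b _ h => by simpa [Fin.ext_iff] using h) fun k hk => ?_
      exact ⟨⟨k.1, by simpa [s] using hk⟩, by simp, rfl⟩
    simpa using this
  · rw [hb k hk]
    have hlt : k.1 < finrank ℝ K := by simpa [s] using hk
    simp only [v, dif_pos hlt]
    exact (c ⟨k.1, hlt⟩).2

/-- If `A` agrees in norm with `B` on `K`, its Frobenius norm is controlled by that of `B` and
the codimension of `K`. -/
theorem frobSq_le_of_subspace {A B : Matrix (Fin n) (Fin n) ℝ} {c : ℝ}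
    (K : Submodule ℝ (EuclideanSpace ℝ (Fin n)))
    (hA : ∀ x, ‖toEuclideanLin A x‖ ≤ c * ‖x‖)
    (hAB : ∀ x ∈ K, ‖toEuclideanLin A x‖ = ‖toEuclideanLin B x‖) :
    frobSq A ≤ (n - finrank ℝ K) * c ^ 2 + frobSq B := by
  classical
  obtain ⟨b, s, hs, hb⟩ := exists_orthonormalBasis_adapted K
  rw [← sum_norm_sq_orthonormalBasis b A, ← sum_norm_sq_orthonormalBasis b B,
    ← Finset.sum_compl_add_sum s]
  refine add_le_add ?_ ?_
  · have h1 : ∀ k ∈ sᶜ, ‖toEuclideanLin A (b k)‖ ^ 2 ≤ c ^ 2 := fun k _ => by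
      have := hA (b k)
      rw [b.orthonormal.1 k, mul_one] at this
      gcongr
    refine (Finset.sum_le_card_nsmul _ _ _ h1).trans ?_
    rw [nsmul_eq_mul, Finset.card_compl, hs, Fintype.card_fin, Nat.cast_sub]
    simpa using K.finrank_le
  · rw [Finset.sum_congr rfl fun k hk => by rw [hAB _ (hb k hk)]]
    exact Finset.sum_le_sum_of_subset_of_nonneg (Finset.subset_univ _) fun _ _ _ => by positivity

/-- A matrix of small Frobenius norm can be large only on a space of small dimension; this serves to
count large singular values. -/
theorem finrank_mul_sq_le_frobSq {B : Matrix (Fin n) (Fin n) ℝ} {c : ℝ} (hc : 0 ≤ c)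
    (K : Submodule ℝ (EuclideanSpace ℝ (Fin n)))
    (hB : ∀ x ∈ K, c * ‖x‖ ≤ ‖toEuclideanLin B x‖) :
    finrank ℝ K * c ^ 2 ≤ frobSq B := by
  obtain ⟨b, s, hs, hb⟩ := exists_orthonormalBasis_adapted K
  rw [← sum_norm_sq_orthonormalBasis b B, ← hs, ← nsmul_eq_mul]
  refine (Finset.card_nsmul_le_sum s _ _ fun k hk => ?_).trans
    (Finset.sum_le_sum_of_subset_of_nonneg (Finset.subset_univ _) fun _ _ _ => by positivity)
  have := hB _ (hb k hk)
  rw [b.orthonormal.1 k, mul_one] at this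
  gcongr

theorem le_finrank_ker_add {F : Type*} [AddCommGroup F] [Module ℝ F] [FiniteDimensional ℝ F]
    (f : EuclideanSpace ℝ (Fin n) →ₗ[ℝ] F) : n ≤ finrank ℝ F + finrank ℝ (LinearMap.ker f) := by
  have h := f.finrank_range_add_finrank_ker
  rw [finrank_euclideanSpace_fin] at h
  have := (LinearMap.range f).finrank_le
  omega

end LinearAlgebra

/-! ### Operator norm from a net, and the bilinear form of a skew matrix. -/

section OperatorNorm

open Matrix Module

variable {n : ℕ}

theorem inner_toEuclideanLin (A : Matrix (Fin n) (Fin n) ℝ) (x y : EuclideanSpace ℝ (Fin n)) :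
    inner ℝ x (toEuclideanLin A y) = ∑ i, ∑ j, A i j * (x i * y j) := by
  rw [PiLp.inner_apply]
  refine Finset.sum_congr rfl fun i _ => ?_
  simp only [Matrix.toLpLin_apply, Matrix.mulVec, dotProduct, RCLike.inner_apply, conj_trivial,
    Finset.sum_mul]
  exact Finset.sum_congr rfl fun j _ => by ring

theorem inner_toEuclideanLin_transpose (A : Matrix (Fin n) (Fin n) ℝ)
    (x y : EuclideanSpace ℝ (Fin n)) :
    inner ℝ x (toEuclideanLin A y) = inner ℝ (toEuclideanLin Aᵀ x) y := by
  rw [inner_toEuclideanLin, real_inner_comm, inner_toEuclideanLin, Finset.sum_comm]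
  exact Finset.sum_congr rfl fun i _ => Finset.sum_congr rfl fun j _ => by
    rw [Matrix.transpose_apply]; ring

/-- On the sphere a displacement is orthogonal to the base point to first order, so discretization
costs a quadratic term only. This is what makes the factor 7/9 affordable. -/
theorem inner_sub_unit {E : Type*} [NormedAddCommGroup E] [InnerProductSpace ℝ E] {x u : E}
    (hx : ‖x‖ = 1) (hu : ‖u‖ = 1) : inner ℝ (x - u) u = -‖x - u‖ ^ 2 / 2 := by
  rw [norm_sub_sq_real, inner_sub_left, real_inner_self_eq_norm_sq, hx, hu]
  ring

/-- A bound on the bilinear form of `A` over a `1/3`-net of the unit sphere bounds the operator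
norm of `A`, with the loss of a factor `7/9` only. -/
theorem norm_le_of_net {A : Matrix (Fin n) (Fin n) ℝ} {N : Finset (EuclideanSpace ℝ (Fin n))}
    (hN : ∀ x ∈ N, ‖x‖ = 1)
    (hnet : ∀ u : EuclideanSpace ℝ (Fin n), ‖u‖ = 1 → ∃ x ∈ N, ‖x - u‖ ≤ 1 / 3)
    {s : ℝ} (hs : 0 ≤ s)
    (hA : ∀ x ∈ N, ∀ y ∈ N, inner ℝ x (toEuclideanLin A y) < 7 / 9 * s)
    (x : EuclideanSpace ℝ (Fin n)) : ‖toEuclideanLin A x‖ ≤ s * ‖x‖ := by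
  obtain ⟨U, d, V, h⟩ := exists_isSVD A
  have hU : Uᵀ * U = 1 := (Matrix.mem_orthogonalGroup_iff' _ _).1 h.left_orthogonal
  have hV : Vᵀ * V = 1 := (Matrix.mem_orthogonalGroup_iff' _ _).1 h.right_orthogonal
  have hV' : V * Vᵀ = 1 := (Matrix.mem_orthogonalGroup_iff _ _).1 h.right_orthogonal
  have bound : ∀ c : ℝ, 0 ≤ c → (∀ j, d j ≤ c) → ∀ x : EuclideanSpace ℝ (Fin n),
      ‖toEuclideanLin A x‖ ≤ c * ‖x‖ := by
    intro c hc hd x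
    rw [h.eq_mul]
    exact norm_orthogonal_diagonal_le hU hV' hc x fun j _ => by
      rw [abs_of_nonneg (h.nonneg j)]; exact hd j
  refine bound s hs (fun j₀ => ?_) x
  by_contra! hj₀
  -- The form is expanded around a top singular pair `u`, `v`. The two linear terms cost at most `σ
  -- / 18` each and the remainder at most `σ / 9`, leaving `7 σ / 9`.
  obtain ⟨j, -, hj⟩ := Finset.exists_max_image Finset.univ d ⟨j₀, Finset.mem_univ _⟩
  set σ := d j with hσ
  have hσs : s < σ := hj₀.trans_le (hj j₀ (Finset.mem_univ _))
  have hσ0 : 0 < σ := hs.trans_lt hσs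
  have hop := bound σ hσ0.le fun k => hj k (Finset.mem_univ k)
  set e : EuclideanSpace ℝ (Fin n) := EuclideanSpace.single j 1 with he
  set u := toEuclideanLin U e with hu
  set v := toEuclideanLin V e with hv
  have he1 : ‖e‖ = 1 := by simp [he]
  have hu1 : ‖u‖ = 1 := by rw [hu, norm_toEuclideanLin_orthogonal hU, he1]
  have hv1 : ‖v‖ = 1 := by rw [hv, norm_toEuclideanLin_orthogonal hV, he1]
  have hde : toEuclideanLin (diagonal d) e = σ • e := by
    ext k
    by_cases hk : k = j
    · subst hk; simp [Matrix.toLpLin_apply, he, hσ]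
    · simp [Matrix.toLpLin_apply, he, hk]
  have hAv : toEuclideanLin A v = σ • u := by
    rw [h.eq_mul, hv, ← toEuclideanLin_mul, Matrix.mul_assoc, hV, Matrix.mul_one,
      toEuclideanLin_mul, hde, map_smul]
  have hAu : toEuclideanLin Aᵀ u = σ • v := by
    rw [h.eq_mul, hu, ← toEuclideanLin_mul]
    simp only [Matrix.transpose_mul, Matrix.transpose_transpose, Matrix.diagonal_transpose,
      Matrix.mul_assoc, hU, Matrix.mul_one]
    rw [toEuclideanLin_mul, hde, map_smul]
  obtain ⟨x, hx, hxu⟩ := hnet u hu1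
  obtain ⟨y, hy, hyv⟩ := hnet v hv1
  have hlt := hA x hx y hy
  have hx2 := inner_sub_unit (hN x hx) hu1
  have hy2 := inner_sub_unit (hN y hy) hv1
  have hexp : inner ℝ x (toEuclideanLin A y) = σ + σ * inner ℝ (x - u) u + σ * inner ℝ (y - v) v
      + inner ℝ (x - u) (toEuclideanLin A (y - v)) := by
    have h1 : inner ℝ u (toEuclideanLin A (y - v)) = σ * inner ℝ (y - v) v := by
      rw [inner_toEuclideanLin_transpose, hAu, inner_smul_left, real_inner_comm]
      rfl
    have h2 : inner ℝ (x - u) (toEuclideanLin A v) = σ * inner ℝ (x - u) u := by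
      rw [hAv, inner_smul_right]
    have h3 : inner ℝ u (toEuclideanLin A v) = σ := by
      rw [hAv, inner_smul_right, real_inner_self_eq_norm_sq, hu1]; ring
    rw [map_sub, inner_sub_right] at h1
    rw [inner_sub_left] at h2
    have h4 : inner ℝ (x - u) (toEuclideanLin A (y - v)) =
        inner ℝ x (toEuclideanLin A y) - inner ℝ x (toEuclideanLin A v) -
          (inner ℝ u (toEuclideanLin A y) - inner ℝ u (toEuclideanLin A v)) := by
      rw [map_sub, inner_sub_left, inner_sub_right, inner_sub_right]
    linarith
  have hlast : -(σ * (1 / 9)) ≤ inner ℝ (x - u) (toEuclideanLin A (y - v)) := by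
    have h1 := (abs_le.1 (abs_real_inner_le_norm (x - u) (toEuclideanLin A (y - v)))).1
    have h2 : ‖x - u‖ * ‖toEuclideanLin A (y - v)‖ ≤ 1 / 3 * (σ * (1 / 3)) := by
      gcongr
      exact (hop _).trans (by gcongr)
    linarith
  have hx3 : ‖x - u‖ ^ 2 ≤ (1 / 3) ^ 2 := by gcongr
  have hy3 : ‖y - v‖ ^ 2 ≤ (1 / 3) ^ 2 := by gcongr
  rw [hexp, hx2, hy2] at hlt
  nlinarith [mul_le_mul_of_nonneg_left hx3 hσ0.le, mul_le_mul_of_nonneg_left hy3 hσ0.le]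

/-- The matrix `A` with its diagonal replaced by zero. -/
def offDiag (A : Matrix (Fin n) (Fin n) ℝ) : Matrix (Fin n) (Fin n) ℝ :=
  Matrix.of fun i j => if i = j then 0 else A i j

theorem sum_sum_eq_sum_upper (f : Fin n → Fin n → ℝ) (hf : ∀ i, f i i = 0) :
    ∑ i, ∑ j, f i j =
      ∑ p : {p : Fin n × Fin n // p.1 ≤ p.2}, (f p.1.1 p.1.2 + f p.1.2 p.1.1) := by
  have h1 : ∑ i, ∑ j, f i j = ∑ i, ∑ j, (if i ≤ j then f i j else 0)
      + ∑ i, ∑ j, (if i ≤ j then f j i else 0) := by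
    conv_rhs => arg 2; rw [Finset.sum_comm]
    rw [← Finset.sum_add_distrib]
    refine Finset.sum_congr rfl fun i _ => ?_
    rw [← Finset.sum_add_distrib]
    refine Finset.sum_congr rfl fun j _ => ?_
    rcases lt_trichotomy i j with h | h | h
    · simp [h.le, h]
    · subst h; simp [hf]
    · simp [h.le, h]
  rw [h1, ← Finset.sum_add_distrib]
  simp only [← Finset.sum_add_distrib]
  rw [← Finset.sum_subtype (Finset.univ.filter fun p : Fin n × Fin n => p.1 ≤ p.2) (by simp)
    (fun p => f p.1 p.2 + f p.2 p.1), Finset.sum_filter, Fintype.sum_prod_type]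
  refine Finset.sum_congr rfl fun i _ => Finset.sum_congr rfl fun j _ => ?_
  split_ifs <;> simp

/-- Lagrange's identity, with the squared inner product of `x` and `y` dropped. It bounds the sum of
squared coefficients of the independent noise variables. -/
theorem sum_minor_sq_le (x y : Fin n → ℝ) :
    ∑ p : {p : Fin n × Fin n // p.1 ≤ p.2}, (x p.1.1 * y p.1.2 - x p.1.2 * y p.1.1) ^ 2 ≤
      (∑ i, x i ^ 2) * ∑ i, y i ^ 2 := by
  have h := sum_sum_eq_sum_upper (fun i j => (x i * y j - x j * y i) ^ 2 / 2) (by simp)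
  have h1 : ∑ p : {p : Fin n × Fin n // p.1 ≤ p.2},
      (x p.1.1 * y p.1.2 - x p.1.2 * y p.1.1) ^ 2 =
        ∑ i, ∑ j, (x i * y j - x j * y i) ^ 2 / 2 := by
    rw [h]
    exact Finset.sum_congr rfl fun p _ => by ring
  have h2 : ∑ i, ∑ j, (x i * y j - x j * y i) ^ 2 / 2 =
      (∑ i, ∑ j, x i ^ 2 * y j ^ 2) / 2 + (∑ j, ∑ i, x j ^ 2 * y i ^ 2) / 2
        - ∑ i, ∑ j, (x i * y i) * (x j * y j) := by
    conv_rhs => arg 1; arg 2; rw [Finset.sum_comm]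
    simp only [Finset.sum_div, ← Finset.sum_add_distrib, ← Finset.sum_sub_distrib]
    exact Finset.sum_congr rfl fun i _ => Finset.sum_congr rfl fun j _ => by ring
  rw [h1, h2]
  simp only [← Finset.sum_mul_sum]
  nlinarith [mul_self_nonneg (∑ i, x i * y i)]

/-- Pairing `(i, j)` with `(j, i)` leaves only the independent entries, with 2 × 2 minors of `x`,
`y` as coefficients; diagonal indices contribute zero. -/
theorem inner_offDiag_of_skew {A : Matrix (Fin n) (Fin n) ℝ}
    (hA : ∀ i j, i < j → A j i = -A i j) (x y : EuclideanSpace ℝ (Fin n)) :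
    inner ℝ x (toEuclideanLin (offDiag A) y) =
      ∑ p : {p : Fin n × Fin n // p.1 ≤ p.2},
        (x p.1.1 * y p.1.2 - x p.1.2 * y p.1.1) * A p.1.1 p.1.2 := by
  rw [inner_toEuclideanLin, sum_sum_eq_sum_upper _ (by simp [offDiag])]
  refine Finset.sum_congr rfl fun p _ => ?_
  rcases p.2.eq_or_lt with h | h
  · simp [offDiag, h]
  · simp only [offDiag, Matrix.of_apply, if_neg h.ne, if_neg h.ne', hA _ _ h]
    ring

end OperatorNorm

/-! ### Concentration of the noise in operator norm. -/

section Concentration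

open Matrix Module
open scoped NNReal

variable {n : ℕ} {Ω : Type*} [MeasurableSpace Ω] {μ : Measure Ω}
  {M : Matrix (Fin n) (Fin n) ℝ} {Y : Ω → Matrix (Fin n) (Fin n) ℝ}

theorem IsObservation.integral_eq (h : IsObservation M Y μ) {i j : Fin n} (hij : i ≤ j) :
    ∫ ω, Y ω i j ∂μ = M i j := by
  have h1 : (fun ω => Y ω i j) = {ω | Y ω i j = 1}.indicator 1 := by
    ext ω
    rcases h.zero_or_one ω i j with h0 | h0 <;> simp [Set.indicator, h0]
  have h2 : MeasurableSet {ω | Y ω i j = 1} := h.measurable i j (measurableSet_singleton 1)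
  rw [h1, integral_indicator_one h2, h.prob_eq i j hij]

theorem IsObservation.hasSubgaussianMGF [IsProbabilityMeasure μ] (h : IsObservation M Y μ)
    {i j : Fin n} (hij : i ≤ j) :
    HasSubgaussianMGF (fun ω => Y ω i j - M i j) (1 / 4) μ := by
  have := hasSubgaussianMGF_of_mem_Icc (μ := μ) (X := fun ω => Y ω i j) (a := 0) (b := 1)
    (h.measurable i j).aemeasurable (Filter.Eventually.of_forall fun ω => by
      rcases h.zero_or_one ω i j with h0 | h0 <;> simp [h0])
  rw [h.integral_eq hij] at this
  convert this using 1
  simp only [sub_zero, nnnorm_one]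
  norm_num

theorem HasSubgaussianMGF.mono {X : Ω → ℝ} {c c' : ℝ≥0} (h : HasSubgaussianMGF X c μ)
    (hc : c ≤ c') : HasSubgaussianMGF X c' μ where
  integrable_exp_mul := h.integrable_exp_mul
  mgf_le t := (h.mgf_le t).trans (by gcongr)

theorem IsObservation.skew_sub (h : IsObservation M Y μ) (hM : ∀ i j, M j i = 1 - M i j) (ω : Ω)
    (i j : Fin n) (hij : i < j) : (Y ω - M) j i = -(Y ω - M) i j := by
  simp only [Matrix.sub_apply, h.skew ω i j hij, hM i j]
  ring

/-- Hoeffding's inequality: each centred entry has variance proxy 1/4, and the squared minors sum to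
at most 1. -/
theorem IsObservation.measure_inner_ge_le [IsProbabilityMeasure μ] (h : IsObservation M Y μ)
    (hM : ∀ i j, M j i = 1 - M i j) {x y : EuclideanSpace ℝ (Fin n)} (hx : ‖x‖ = 1) (hy : ‖y‖ = 1)
    {t : ℝ} (ht : 0 ≤ t) :
    μ.real {ω | t ≤ inner ℝ x (toEuclideanLin (offDiag (Y ω - M)) y)} ≤ Real.exp (-2 * t ^ 2) := by
  set c : {p : Fin n × Fin n // p.1 ≤ p.2} → ℝ :=
    fun p => x p.1.1 * y p.1.2 - x p.1.2 * y p.1.1 with hc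
  have hind : iIndepFun (fun (p : {p : Fin n × Fin n // p.1 ≤ p.2}) ω =>
      c p * (Y ω p.1.1 p.1.2 - M p.1.1 p.1.2)) μ :=
    h.indep.comp (fun p z => c p * (z - M p.1.1 p.1.2)) fun p => by fun_prop
  have hsub := HasSubgaussianMGF.sum_of_iIndepFun hind (s := Finset.univ)
    fun p _ => (h.hasSubgaussianMGF p.2).const_mul (c p)
  have hfin := (HasSubgaussianMGF.mono (c' := 1 / 4) hsub ?_).measure_ge_le ht
  swap
  · rw [← NNReal.coe_le_coe, NNReal.coe_sum]
    have := sum_minor_sq_le x y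
    rw [← EuclideanSpace.real_norm_sq_eq, ← EuclideanSpace.real_norm_sq_eq, hx, hy] at this
    have h1 : ∑ p, c p ^ 2 ≤ 1 := by simpa using this
    have h2 : ∑ p, c p ^ 2 * (1 / 4) ≤ 1 / 4 := by
      rw [← Finset.sum_mul]
      linarith
    rw [show ((1 / 4 : ℝ≥0) : ℝ) = 1 / 4 by norm_num]
    refine le_trans (le_of_eq (Finset.sum_congr rfl fun p _ => ?_)) h2
    refine (NNReal.coe_mul _ _).trans ?_
    rw [show ((1 / 4 : ℝ≥0) : ℝ) = 1 / 4 by norm_num]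
    rfl
  have hset : {ω | t ≤ inner ℝ x (toEuclideanLin (offDiag (Y ω - M)) y)} =
      {ω | t ≤ ∑ p, c p * (Y ω p.1.1 p.1.2 - M p.1.1 p.1.2)} := by
    ext ω
    rw [Set.mem_ofPred_eq, Set.mem_ofPred_eq, inner_offDiag_of_skew (h.skew_sub hM ω)]
    rfl
  rw [hset]
  refine hfin.trans_eq ?_
  congr 1
  rw [show ((1 / 4 : ℝ≥0) : ℝ) = 1 / 4 by norm_num]
  ring

theorem norm_sub_offDiag_le {A : Matrix (Fin n) (Fin n) ℝ} {c : ℝ} (hc : 0 ≤ c)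
    (hA : ∀ i, |A i i| ≤ c) (x : EuclideanSpace ℝ (Fin n)) :
    ‖toEuclideanLin (A - offDiag A) x‖ ≤ c * ‖x‖ := by
  have hdiag : A - offDiag A = (1 : Matrix (Fin n) (Fin n) ℝ) * diagonal (fun i => A i i) *
      (1 : Matrix (Fin n) (Fin n) ℝ)ᵀ := by
    rw [Matrix.one_mul, Matrix.transpose_one, Matrix.mul_one]
    ext i j
    by_cases hij : i = j
    · subst hij; simp [offDiag]
    · simp [offDiag, hij]
  rw [hdiag]
  exact norm_orthogonal_diagonal_le (by simp) (by simp) hc x fun j _ => hA j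

/-- The noise matrix has operator norm at most `2 √n + 1/2` with overwhelming probability. -/
theorem IsObservation.measure_norm_gt_le [IsProbabilityMeasure μ] (h : IsObservation M Y μ)
    (hM : ∀ i j, M j i = 1 - M i j) :
    μ.real {ω | ¬ ∀ x, ‖toEuclideanLin (Y ω - M) x‖ ≤ (2 * √(n : ℝ) + 1 / 2) * ‖x‖} ≤
      Real.exp (-(4 / 5) * n) := by
  obtain ⟨N, hcard, hN, hnet⟩ := exists_net (EuclideanSpace ℝ (Fin n))
  rw [finrank_euclideanSpace_fin] at hcard
  set t : ℝ := 7 / 9 * (2 * √(n : ℝ)) with ht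
  have hsub : {ω | ¬ ∀ x, ‖toEuclideanLin (Y ω - M) x‖ ≤ (2 * √(n : ℝ) + 1 / 2) * ‖x‖} ⊆
      ⋃ p ∈ N ×ˢ N, {ω | t ≤ inner ℝ p.1 (toEuclideanLin (offDiag (Y ω - M)) p.2)} := by
    intro ω hω
    by_contra hcon
    refine hω fun x => ?_
    simp only [Set.mem_iUnion, Set.mem_ofPred_eq, not_exists, not_le, Finset.mem_product,
      Prod.forall, and_imp] at hcon
    have h1 := norm_le_of_net hN hnet (s := 2 * √(n : ℝ)) (by positivity)
      (fun x hx y hy => hcon x y hx hy) x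
    -- The diagonal is not skew, but `M i i = 1 / 2` makes each diagonal noise entry `± 1 / 2`.
    have h2 : ‖toEuclideanLin ((Y ω - M) - offDiag (Y ω - M)) x‖ ≤ 1 / 2 * ‖x‖ := by
      refine norm_sub_offDiag_le (by norm_num) (fun i => ?_) x
      have : M i i = 1 / 2 := by linarith [hM i i]
      rw [Matrix.sub_apply, this]
      rcases h.zero_or_one ω i i with h0 | h0 <;> rw [h0] <;> norm_num [abs_le]
    calc ‖toEuclideanLin (Y ω - M) x‖
        = ‖toEuclideanLin (offDiag (Y ω - M)) x
          + toEuclideanLin ((Y ω - M) - offDiag (Y ω - M)) x‖ := by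
          rw [← LinearMap.add_apply, ← map_add, add_sub_cancel]
      _ ≤ _ := norm_add_le _ _
      _ ≤ _ := by rw [add_mul]; exact add_le_add h1 h2
  have hbound : ∀ p ∈ N ×ˢ N,
      μ.real {ω | t ≤ inner ℝ p.1 (toEuclideanLin (offDiag (Y ω - M)) p.2)} ≤
        Real.exp (-2 * t ^ 2) := fun p hp => by
    rw [Finset.mem_product] at hp
    exact h.measure_inner_ge_le hM (hN _ hp.1) (hN _ hp.2) (by positivity)
  have ht2 : t ^ 2 = 196 / 81 * n := by
    rw [ht, mul_pow, mul_pow, Real.sq_sqrt (Nat.cast_nonneg n)]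
    ring
  -- There are at most `49 ^ n` pairs of net points, while `2 t² = (392 / 81) n` exceeds `4.8 n`;
  -- this leaves the rate 4/5.
  have h49 : (49 : ℝ) ≤ Real.exp 4 := by
    have h1 : (2.7182818283 : ℝ) ^ 4 ≤ Real.exp 1 ^ 4 := by
      gcongr
      exact Real.exp_one_gt_d9.le
    rw [← Real.exp_nat_mul] at h1
    norm_num at h1
    linarith
  calc μ.real {ω | ¬ ∀ x, ‖toEuclideanLin (Y ω - M) x‖ ≤ (2 * √(n : ℝ) + 1 / 2) * ‖x‖}
      ≤ μ.real (⋃ p ∈ N ×ˢ N,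
          {ω | t ≤ inner ℝ p.1 (toEuclideanLin (offDiag (Y ω - M)) p.2)}) := measureReal_mono hsub (measure_ne_top _ _)
    _ ≤ ∑ p ∈ N ×ˢ N,
        μ.real {ω | t ≤ inner ℝ p.1 (toEuclideanLin (offDiag (Y ω - M)) p.2)} :=
      measureReal_biUnion_finset_le _ _
    _ ≤ (N ×ˢ N).card • Real.exp (-2 * t ^ 2) := Finset.sum_le_card_nsmul _ _ _ hbound
    _ ≤ (49 : ℝ) ^ n * Real.exp (-2 * t ^ 2) := by
      rw [nsmul_eq_mul, Finset.card_product]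
      gcongr
      have : N.card * N.card ≤ 7 ^ n * 7 ^ n := Nat.mul_le_mul hcard hcard
      rw [← mul_pow] at this
      exact_mod_cast this
    _ ≤ Real.exp 4 ^ n * Real.exp (-2 * t ^ 2) := by gcongr
    _ = Real.exp (n * 4 + -2 * t ^ 2) := by rw [← Real.exp_nat_mul, ← Real.exp_add]
    _ ≤ Real.exp (-(4 / 5) * n) := by
      rw [ht2]
      gcongr
      have : (0 : ℝ) ≤ n := Nat.cast_nonneg n
      linarith

end Concentration

/-! ### Oracle inequality and approximation of SST matrices. -/

section UpperBound

open Matrix Module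

variable {n : ℕ}

/-- A matrix with rows drawn from `R` is killed by `r` linear conditions, and the coordinates in `J`
add `J.card` more. -/
theorem exists_submodule_ker_coord {r : ℕ} (g : Fin n → Fin r) (R : Fin r → Fin n → ℝ)
    (V : Matrix (Fin n) (Fin n) ℝ) (J : Finset (Fin n)) :
    ∃ K : Submodule ℝ (EuclideanSpace ℝ (Fin n)), n ≤ r + J.card + finrank ℝ K ∧
      ∀ x ∈ K, toEuclideanLin (Matrix.of fun i => R (g i)) x = 0 ∧
        ∀ j ∈ J, toEuclideanLin V x j = 0 := by
  let f₁ : EuclideanSpace ℝ (Fin n) →ₗ[ℝ] Fin r → ℝ :=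
    Matrix.mulVecLin (Matrix.of R) ∘ₗ (WithLp.linearEquiv 2 ℝ (Fin n → ℝ)).toLinearMap
  let f₂ : EuclideanSpace ℝ (Fin n) →ₗ[ℝ] J → ℝ :=
    LinearMap.funLeft ℝ ℝ (Subtype.val : J → Fin n) ∘ₗ
      (WithLp.linearEquiv 2 ℝ (Fin n → ℝ)).toLinearMap ∘ₗ toEuclideanLin V
  refine ⟨LinearMap.ker (f₁.prod f₂), ?_, fun x hx => ?_⟩
  · have := le_finrank_ker_add (f₁.prod f₂)
    simpa using this
  · have h : f₁ x = 0 ∧ f₂ x = 0 := by simpa using hx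
    refine ⟨?_, fun j hj => congrFun h.2 ⟨j, hj⟩⟩
    ext i
    exact congrFun h.1 (g i)

theorem softThreshold_sub_abs_le {t : ℝ} (ht : 0 ≤ t) {d : Fin n → ℝ} (hd : ∀ j, 0 ≤ d j)
    (j : Fin n) : |(d - softThreshold t d) j| ≤ t := by
  have := hd j
  simp only [Pi.sub_apply, softThreshold, abs_le]
  rcases le_total (d j - t) 0 with h | h
  · rw [max_eq_left h]; constructor <;> linarith
  · rw [max_eq_right h]; constructor <;> linarith

theorem sub_softSVT_eq {t : ℝ} (ht : 0 ≤ t) {Y U V : Matrix (Fin n) (Fin n) ℝ} {d : Fin n → ℝ}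
    (h : IsSVD Y U d V) :
    Y - softSVT t Y = U * diagonal (d - softThreshold t d) * Vᵀ := by
  rw [softSVT_eq ht h]
  nth_rewrite 1 [h.eq_mul]
  rw [← Matrix.sub_mul, ← Matrix.mul_sub, Matrix.diagonal_sub]
  rfl

/-- Oracle inequality for soft singular value thresholding: if the noise `Y - M` has operator
norm at most `c < t`, the error is controlled by the approximation of `M` by a matrix with at
most `r` distinct rows. -/
theorem frobSq_softSVT_sub_le {t c : ℝ} (hc : 0 ≤ c) (hct : c < t)
    {Y M : Matrix (Fin n) (Fin n) ℝ}
    (hW : ∀ x, ‖toEuclideanLin (Y - M) x‖ ≤ c * ‖x‖) {r : ℕ} (g : Fin n → Fin r)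
    (R : Fin r → Fin n → ℝ) :
    frobSq (softSVT t Y - M) ≤
      (2 * r + frobSq (M - Matrix.of fun i => R (g i)) / (t - c) ^ 2) * (t + c) ^ 2
        + frobSq (M - Matrix.of fun i => R (g i)) := by
  classical
  set B : Matrix (Fin n) (Fin n) ℝ := Matrix.of fun i => R (g i) with hB
  have ht : 0 ≤ t := hc.trans hct.le
  obtain ⟨U, d, V, h⟩ := exists_isSVD Y
  have hU : Uᵀ * U = 1 := (Matrix.mem_orthogonalGroup_iff' _ _).1 h.left_orthogonal
  have hV : V * Vᵀ = 1 := (Matrix.mem_orthogonalGroup_iff _ _).1 h.right_orthogonal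
  set J : Finset (Fin n) := Finset.univ.filter fun j => t < d j with hJ
  have hJcard : (J.card : ℝ) ≤ r + frobSq (M - B) / (t - c) ^ 2 := by
    -- On this `K`, of dimension at least `J.card - r`, `Y` expands by at least `t` and `B`
    -- vanishes, so `M - B` must expand by at least `t - c`.
    obtain ⟨K, hK, hKx⟩ := exists_submodule_ker_coord g R Vᵀ Jᶜ
    have hlow : ∀ x ∈ K, (t - c) * ‖x‖ ≤ ‖toEuclideanLin (M - B) x‖ := by
      intro x hx
      obtain ⟨hBx, hcoord⟩ := hKx x hx
      have h1 : t * ‖x‖ ≤ ‖toEuclideanLin Y x‖ := by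
        rw [h.eq_mul]
        refine le_norm_orthogonal_diagonal hU hV ht x fun j hj => ?_
        by_contra! hlt
        refine hj (hcoord j ?_)
        simp [hJ, hlt.le]
      have h2 := hW x
      have h3 : toEuclideanLin Y x = toEuclideanLin (M - B) x + toEuclideanLin (Y - M) x := by
        rw [map_sub, map_sub, LinearMap.sub_apply, LinearMap.sub_apply, hBx]
        abel
      have h4 := norm_add_le (toEuclideanLin (M - B) x) (toEuclideanLin (Y - M) x)
      rw [← h3] at h4
      linarith
    have h1 := finrank_mul_sq_le_frobSq (sub_nonneg.2 hct.le) K hlow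
    have hpos : 0 < (t - c) ^ 2 := pow_pos (sub_pos.2 hct) 2
    rw [← le_div_iff₀ hpos] at h1
    have h2 : J.card ≤ r + finrank ℝ K := by
      have hJle : J.card ≤ n := by simpa using J.card_le_univ
      rw [Finset.card_compl, Fintype.card_fin] at hK
      omega
    have h3 : (J.card : ℝ) ≤ r + finrank ℝ K := by exact_mod_cast h2
    linarith
  -- On this second `K` both the thresholded matrix and `B` vanish, so the error equals that of `B`
  -- in norm; in the complementary directions the bound `t + c` applies.
  obtain ⟨K, hK, hKx⟩ := exists_submodule_ker_coord g R Vᵀ J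
  have hop : ∀ x, ‖toEuclideanLin (softSVT t Y - M) x‖ ≤ (t + c) * ‖x‖ := by
    intro x
    have h1 : ‖toEuclideanLin (Y - softSVT t Y) x‖ ≤ t * ‖x‖ := by
      rw [sub_softSVT_eq ht h]
      exact norm_orthogonal_diagonal_le hU hV ht x fun j _ => softThreshold_sub_abs_le ht h.nonneg j
    have h2 : toEuclideanLin (softSVT t Y - M) x =
        toEuclideanLin (Y - M) x - toEuclideanLin (Y - softSVT t Y) x := by
      simp only [map_sub, LinearMap.sub_apply]
      abel
    rw [h2]
    refine (norm_sub_le _ _).trans ?_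
    linarith [hW x]
  have hag : ∀ x ∈ K, ‖toEuclideanLin (softSVT t Y - M) x‖ = ‖toEuclideanLin (M - B) x‖ := by
    intro x hx
    obtain ⟨hBx, hcoord⟩ := hKx x hx
    have h1 : toEuclideanLin (softSVT t Y) x = 0 := by
      rw [← norm_le_zero_iff, softSVT_eq ht h]
      refine (norm_orthogonal_diagonal_le hU hV le_rfl x fun j hj => ?_).trans_eq (zero_mul _)
      have : d j ≤ t := by
        by_contra! hlt
        exact hj (hcoord j (by simp [hJ, hlt]))
      simp [softThreshold, this]
    rw [map_sub, map_sub, LinearMap.sub_apply, LinearMap.sub_apply, h1, hBx, zero_sub, sub_zero,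
      norm_neg]
  have hmain := frobSq_le_of_subspace K hop hag
  have h2 : (n : ℝ) - finrank ℝ K ≤ 2 * r + frobSq (M - B) / (t - c) ^ 2 := by
    have : (n : ℝ) ≤ r + J.card + finrank ℝ K := by exact_mod_cast hK
    linarith
  refine hmain.trans ?_
  gcongr

theorem SST.row_comparable {M : Matrix (Fin n) (Fin n) ℝ} (hM : M ∈ SST n) (i j : Fin n) :
    (∀ k, M j k ≤ M i k) ∨ ∀ k, M i k ≤ M j k := by
  obtain ⟨-, -, π, hπ⟩ := hM
  rcases lt_trichotomy (π i) (π j) with h | h | h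
  · exact Or.inl (hπ i j h)
  · rw [π.injective h]; exact Or.inl fun _ => le_rfl
  · exact Or.inr (hπ j i h)

/-- The entry differences share one sign, so nothing cancels in the sum, and they lie in `[-1, 1]`,
so squaring does not increase their size. -/
theorem SST.sum_row_sub_sq_le {M : Matrix (Fin n) (Fin n) ℝ} (hM : M ∈ SST n) (i j : Fin n) :
    ∑ k, (M i k - M j k) ^ 2 ≤ |∑ k, M i k - ∑ k, M j k| := by
  rw [← Finset.sum_sub_distrib]
  have key : ∀ k, 0 ≤ M i k ∧ M i k ≤ 1 ∧ 0 ≤ M j k ∧ M j k ≤ 1 := fun k =>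
    ⟨(hM.1 i k).1, (hM.1 i k).2, (hM.1 j k).1, (hM.1 j k).2⟩
  rcases SST.row_comparable hM i j with h | h
  · refine le_trans (Finset.sum_le_sum fun k _ => ?_) (le_abs_self _)
    obtain ⟨h1, h2, h3, h4⟩ := key k
    nlinarith [h k]
  · refine le_trans ?_ (neg_le_abs _)
    rw [← Finset.sum_neg_distrib]
    refine Finset.sum_le_sum fun k _ => ?_
    obtain ⟨h1, h2, h3, h4⟩ := key k
    nlinarith [h k]

/-- An SST matrix is close to a matrix with at most `2 √n` distinct rows. -/
theorem SST.exists_approx {M : Matrix (Fin n) (Fin n) ℝ} (hM : M ∈ SST n) (hn : 1 ≤ n) :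
    ∃ (r : ℕ) (g : Fin n → Fin r) (R : Fin r → Fin n → ℝ), (r : ℝ) ≤ 2 * √(n : ℝ) ∧
      frobSq (M - Matrix.of fun i => R (g i)) ≤ n * √(n : ℝ) := by
  have : Nonempty (Fin n) := ⟨⟨0, hn⟩⟩
  have hn1 : (1 : ℝ) ≤ √(n : ℝ) := Real.one_le_sqrt.2 (by exact_mod_cast hn)
  have hs : 0 < √(n : ℝ) := zero_lt_one.trans_le hn1
  have hsum0 : ∀ i, 0 ≤ (∑ k, M i k) / √(n : ℝ) := fun i =>
    div_nonneg (Finset.sum_nonneg fun k _ => (hM.1 i k).1) hs.le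
  have hsum1 : ∀ i, (∑ k, M i k) / √(n : ℝ) ≤ √(n : ℝ) := fun i => by
    rw [div_le_iff₀ hs, Real.mul_self_sqrt (Nat.cast_nonneg n)]
    refine (Finset.sum_le_card_nsmul _ _ 1 fun k _ => (hM.1 i k).2).trans_eq ?_
    simp
  -- Rows are binned by their sum in steps of `√n`; `Function.invFun g` then picks a representative
  -- row of each nonempty bin.
  let g : Fin n → Fin (⌊√(n : ℝ)⌋₊ + 1) := fun i =>
    ⟨⌊(∑ k, M i k) / √(n : ℝ)⌋₊, Nat.lt_succ_of_le (Nat.floor_le_floor (hsum1 i))⟩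
  refine ⟨⌊√(n : ℝ)⌋₊ + 1, g, fun k => M (Function.invFun g k), ?_, ?_⟩
  · push_cast
    linarith [Nat.floor_le hs.le]
  · have hrow : ∀ i, ∑ j, (M i j - M (Function.invFun g (g i)) j) ^ 2 ≤ √(n : ℝ) := by
      intro i
      set i' := Function.invFun g (g i)
      have hg : g i' = g i := Function.invFun_eq ⟨i, rfl⟩
      have hfl : ⌊(∑ k, M i' k) / √(n : ℝ)⌋₊ = ⌊(∑ k, M i k) / √(n : ℝ)⌋₊ := congrArg Fin.val hg
      refine (SST.sum_row_sub_sq_le hM i i').trans ?_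
      have a1 := Nat.floor_le (hsum0 i)
      have a2 := Nat.lt_floor_add_one ((∑ k, M i k) / √(n : ℝ))
      have b1 := Nat.floor_le (hsum0 i')
      have b2 := Nat.lt_floor_add_one ((∑ k, M i' k) / √(n : ℝ))
      rw [hfl] at b1 b2
      have h1 : |(∑ k, M i k) / √(n : ℝ) - (∑ k, M i' k) / √(n : ℝ)| ≤ 1 := by
        rw [abs_le]; constructor <;> linarith
      rwa [← sub_div, abs_div, abs_of_pos hs, div_le_one hs] at h1
    refine (Finset.sum_le_card_nsmul _ _ _ fun i _ => hrow i).trans_eq ?_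
    simp

/-- The error bound for SST matrices on the event that the noise has operator norm at most
`2.05 √n`. -/
theorem SST.normalizedError_lt {M Y : Matrix (Fin n) (Fin n) ℝ} (hM : M ∈ SST n) (hn : 1 ≤ n)
    (hW : ∀ x, ‖toEuclideanLin (Y - M) x‖ ≤ 2.05 * √(n : ℝ) * ‖x‖) :
    normalizedError (softSVT (2.1 * √(n : ℝ)) Y) M < 10000 / √(n : ℝ) := by
  obtain ⟨r, g, R, hr, hF⟩ := SST.exists_approx hM hn
  have hn0 : (0 : ℝ) < n := by exact_mod_cast hn
  have hs : 0 < √(n : ℝ) := Real.sqrt_pos.2 hn0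
  have hss : √(n : ℝ) * √(n : ℝ) = n := Real.mul_self_sqrt hn0.le
  have h := frobSq_softSVT_sub_le (by positivity) (by nlinarith) hW g R (t := 2.1 * √(n : ℝ))
  set F := frobSq (M - Matrix.of fun i => R (g i)) with hFdef
  have e1 : (2.1 * √(n : ℝ) - 2.05 * √(n : ℝ)) ^ 2 = n / 400 := by
    linear_combination (1 / 400) * hss
  have e2 : (2.1 * √(n : ℝ) + 2.05 * √(n : ℝ)) ^ 2 = 17.2225 * n := by
    linear_combination 17.2225 * hss
  rw [e1, e2] at h
  -- The factor 400 comes from the gap `0.05 √n` between threshold and noise level; the final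
  -- constant is `404 * 17.2225 + 1 < 10000`.
  have h1 : F / (n / 400) ≤ 400 * √(n : ℝ) := by
    rw [div_le_iff₀ (by positivity)]
    linarith
  have h2 : (2 * r + F / (n / 400)) * (17.2225 * n) ≤ (404 * √(n : ℝ)) * (17.2225 * n) := by
    gcongr
    linarith
  rw [normalizedError_eq, div_lt_div_iff₀ (by positivity) hs]
  have h3 : frobSq (softSVT (2.1 * √(n : ℝ)) Y - M) < 10000 * (n * √(n : ℝ)) := by
    have : 0 < n * √(n : ℝ) := by positivity
    linarith
  calc frobSq (softSVT (2.1 * √(n : ℝ)) Y - M) * √(n : ℝ)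
      < 10000 * (n * √(n : ℝ)) * √(n : ℝ) := by gcongr
    _ = 10000 * (n : ℝ) ^ 2 := by linear_combination 10000 * (n : ℝ) * hss

end UpperBound

/-! ### Probabilistic form of the upper bound. -/

section Probability

variable {n : ℕ} {Ω : Type*} [MeasurableSpace Ω] {μ : Measure Ω} [IsProbabilityMeasure μ]
  {M : Matrix (Fin n) (Fin n) ℝ} {Y : Ω → Matrix (Fin n) (Fin n) ℝ}

theorem IsObservation.measure_normalizedError_ge_le (h : IsObservation M Y μ) (hM : M ∈ SST n)
    (hn : 2 ≤ n) :
    μ.real {ω | 10000 / √(n : ℝ) ≤ normalizedError (softSVT (2.1 * √(n : ℝ)) (Y ω)) M} ≤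
      Real.exp 80 * Real.exp (-(4 / 5) * n) := by
  -- For `n ≤ 100` the factor `exp 80` makes the bound trivial; beyond that `√n ≥ 10` absorbs the
  -- diagonal term 1/2 into `0.05 √n`.
  rcases le_or_gt n 100 with hsmall | hlarge
  · rw [← Real.exp_add]
    refine measureReal_le_one.trans (Real.one_le_exp ?_)
    have : (n : ℝ) ≤ 100 := by exact_mod_cast hsmall
    linarith
  · have hsub : {ω | 10000 / √(n : ℝ) ≤ normalizedError (softSVT (2.1 * √(n : ℝ)) (Y ω)) M} ⊆
        {ω | ¬ ∀ x, ‖Matrix.toEuclideanLin (Y ω - M) x‖ ≤ (2 * √(n : ℝ) + 1 / 2) * ‖x‖} := by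
      intro ω hω hW
      refine (SST.normalizedError_lt hM (by omega) fun x => (hW x).trans ?_).not_ge hω
      have : (10 : ℝ) ≤ √(n : ℝ) := by
        rw [Real.le_sqrt (by norm_num) (by positivity)]
        have : (100 : ℝ) ≤ n := by exact_mod_cast hlarge.le
        linarith
      gcongr
      linarith
    refine (measureReal_mono hsub (measure_ne_top _ _)).trans ?_
    refine (h.measure_norm_gt_le hM.2.1).trans ?_
    exact le_mul_of_one_le_left (Real.exp_pos _).le (Real.one_le_exp (by norm_num))

end Probability

/-! ### Lower bounds at the constant matrix 1/2. -/

section LowerBound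

open Matrix Module

variable {n : ℕ}

/-- The SST matrix of indistinguishable items. -/
noncomputable def halfMatrix (n : ℕ) : Matrix (Fin n) (Fin n) ℝ := Matrix.of fun _ _ => 1 / 2

theorem halfMatrix_mem_SST : halfMatrix n ∈ SST n := by
  refine ⟨fun i j => ?_, fun i j => ?_, 1, fun i j _ k => le_rfl⟩
  · norm_num [halfMatrix]
  · norm_num [halfMatrix]

theorem frobSq_halfMatrix : frobSq (halfMatrix n) = (n / 2 : ℝ) ^ 2 := by
  simp [frobSq, halfMatrix]
  ring

theorem frobSq_sub_halfMatrix {Y : Matrix (Fin n) (Fin n) ℝ}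
    (hY : ∀ i j, Y i j = 0 ∨ Y i j = 1) : frobSq (Y - halfMatrix n) = (n / 2 : ℝ) ^ 2 := by
  rw [← frobSq_halfMatrix]
  refine Finset.sum_congr rfl fun i _ => Finset.sum_congr rfl fun j _ => ?_
  rcases hY i j with h | h <;> norm_num [halfMatrix, h]

theorem frobSq_sub_softSVT_le {t : ℝ} (ht : 0 ≤ t) (Y : Matrix (Fin n) (Fin n) ℝ) :
    frobSq (Y - softSVT t Y) ≤ n * t ^ 2 := by
  obtain ⟨U, d, V, h⟩ := exists_isSVD Y
  have hU : Uᵀ * U = 1 := (Matrix.mem_orthogonalGroup_iff' _ _).1 h.left_orthogonal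
  have hV : Vᵀ * V = 1 := (Matrix.mem_orthogonalGroup_iff' _ _).1 h.right_orthogonal
  rw [sub_softSVT_eq ht h, frobSq_orthogonal_diagonal hU hV]
  refine (Finset.sum_le_card_nsmul _ _ (t ^ 2) fun j _ => ?_).trans_eq (by simp)
  exact sq_le_sq' (neg_le_of_abs_le (softThreshold_sub_abs_le ht h.nonneg j))
    (le_of_abs_le (softThreshold_sub_abs_le ht h.nonneg j))

theorem sqrt_frobSq_sub_comm (A B : Matrix (Fin n) (Fin n) ℝ) :
    √(frobSq (A - B)) = √(frobSq (B - A)) := by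
  congr 1
  exact Finset.sum_congr rfl fun i _ => Finset.sum_congr rfl fun j _ => by
    simp only [Matrix.sub_apply]; ring

/-- Thresholding at a low level leaves most of the noise in place. -/
theorem le_sqrt_frobSq_of_small_threshold {t : ℝ} (ht : 0 ≤ t) (htn : t ≤ 9 / 20 * √(n : ℝ))
    {Y : Matrix (Fin n) (Fin n) ℝ} (hY : ∀ i j, Y i j = 0 ∨ Y i j = 1) :
    (n : ℝ) / 20 ≤ √(frobSq (softSVT t Y - halfMatrix n)) := by
  have h1 := sqrt_frobSq_triangle Y (softSVT t Y) (halfMatrix n)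
  rw [frobSq_sub_halfMatrix hY, Real.sqrt_sq (by positivity)] at h1
  have h2 : √(frobSq (Y - softSVT t Y)) ≤ 9 / 20 * n := by
    refine Real.sqrt_le_iff.2 ⟨by positivity, (frobSq_sub_softSVT_le ht Y).trans ?_⟩
    have : t ^ 2 ≤ (9 / 20 * √(n : ℝ)) ^ 2 := by gcongr
    rw [mul_pow, Real.sq_sqrt (Nat.cast_nonneg n)] at this
    nlinarith [mul_le_mul_of_nonneg_left this (Nat.cast_nonneg (α := ℝ) n)]
  linarith

/-- The residual of soft thresholding is `t` times a subgradient of the nuclear norm at the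
thresholded matrix. -/
theorem mul_sqrt_frobSq_softSVT_le {t : ℝ} (ht : 0 ≤ t) (Y : Matrix (Fin n) (Fin n) ℝ) :
    t * √(frobSq (softSVT t Y)) ≤ ((Y - softSVT t Y)ᵀ * softSVT t Y).trace := by
  obtain ⟨U, d, V, h⟩ := exists_isSVD Y
  have hU : Uᵀ * U = 1 := (Matrix.mem_orthogonalGroup_iff' _ _).1 h.left_orthogonal
  have hV : Vᵀ * V = 1 := (Matrix.mem_orthogonalGroup_iff' _ _).1 h.right_orthogonal
  rw [sub_softSVT_eq ht h, softSVT_eq ht h, trace_orthogonal_diagonal hU hV,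
    frobSq_orthogonal_diagonal hU hV]
  have h0 : ∀ j, 0 ≤ softThreshold t d j := fun j => le_max_left _ _
  have h1 : ∀ j, (d - softThreshold t d) j * softThreshold t d j = t * softThreshold t d j := by
    intro j
    simp only [Pi.sub_apply, softThreshold]
    rcases le_total (d j - t) 0 with h | h
    · rw [max_eq_left h]; ring
    · rw [max_eq_right h]; ring
  rw [Finset.sum_congr rfl fun j _ => h1 j, ← Finset.mul_sum]
  gcongr
  refine Real.sqrt_le_iff.2 ⟨Finset.sum_nonneg fun j _ => h0 j, ?_⟩
  exact Finset.sum_sq_le_sq_sum_of_nonneg fun j _ => h0 j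

/-- Skewness cancels the off-diagonal noise against a constant matrix, leaving at most 1/4 per
diagonal entry. -/
theorem trace_noise_halfMatrix_le {Y : Matrix (Fin n) (Fin n) ℝ}
    (hY : ∀ i j, Y i j = 0 ∨ Y i j = 1) (hskew : ∀ i j, i < j → Y j i = 1 - Y i j) :
    ((Y - halfMatrix n)ᵀ * halfMatrix n).trace ≤ n / 4 := by
  have h1 : ((Y - halfMatrix n)ᵀ * halfMatrix n).trace = ∑ i, ∑ j, (Y i j - 1 / 2) / 2 := by
    simp only [Matrix.trace, Matrix.diag, Matrix.mul_apply, Matrix.transpose_apply,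
      Matrix.sub_apply, halfMatrix, Matrix.of_apply]
    rw [Finset.sum_comm]
    exact Finset.sum_congr rfl fun i _ => Finset.sum_congr rfl fun j _ => by ring
  have h2 : ∑ i, ∑ j, (Y i j - 1 / 2) / 2 + ∑ i, ∑ j, (Y i j - 1 / 2) / 2 ≤ n / 2 := by
    nth_rewrite 2 [Finset.sum_comm]
    rw [← Finset.sum_add_distrib]
    refine (Finset.sum_le_card_nsmul _ _ (1 / 2) fun i _ => ?_).trans_eq (by simp; ring)
    rw [← Finset.sum_add_distrib]
    rw [Finset.sum_eq_single i]
    · rcases hY i i with h | h <;> rw [h] <;> norm_num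
    · intro j _ hj
      rcases lt_or_gt_of_ne hj with h | h
      · rw [hskew j i h]; ring
      · rw [hskew i j h]; ring
    · simp
  rw [h1]
  linarith

/-- Thresholding at a high level biases the estimate of the constant matrix. -/
theorem le_sqrt_frobSq_of_large_threshold {t : ℝ} (hn : 2 ≤ n) (htn : 9 / 20 * √(n : ℝ) ≤ t)
    {Y : Matrix (Fin n) (Fin n) ℝ} (hY : ∀ i j, Y i j = 0 ∨ Y i j = 1)
    (hskew : ∀ i j, i < j → Y j i = 1 - Y i j) :
    3 / 100 ≤ √(frobSq (softSVT t Y - halfMatrix n)) := by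
  have hn' : (2 : ℝ) ≤ n := by exact_mod_cast hn
  have ht' : (63 / 100 : ℝ) ≤ t := by
    have : (7 / 5 : ℝ) ≤ √(n : ℝ) := by
      rw [Real.le_sqrt (by norm_num) (by positivity)]
      linarith
    linarith
  have ht : 0 ≤ t := by linarith
  set M := halfMatrix n with hM
  set T := softSVT t Y with hT
  set Δ := T - M with hΔ
  set e := √(frobSq Δ) with he
  have he0 : 0 ≤ e := Real.sqrt_nonneg _
  have hMn : √(frobSq M) = n / 2 := by rw [frobSq_halfMatrix, Real.sqrt_sq (by positivity)]
  have hYM : √(frobSq (Y - M)) = n / 2 := by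
    rw [frobSq_sub_halfMatrix hY, Real.sqrt_sq (by positivity)]
  have h1 : t * √(frobSq T) ≤ ((Y - T)ᵀ * T).trace := mul_sqrt_frobSq_softSVT_le ht Y
  -- With `T = M + Δ` and `‖Δ‖ = e`, the right side is at most `n / 4 + n e`, while the subgradient
  -- bound forces at least `t (n / 2 - e)`. As `t` exceeds 1/2 by a margin, `e` cannot be tiny.
  have h2 : ((Y - T)ᵀ * T).trace = ((Y - M)ᵀ * M).trace + ((Y - M)ᵀ * Δ).trace
      - (Δᵀ * M).trace - frobSq Δ := by
    rw [frobSq_eq_trace]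
    have hT' : T = M + Δ := by rw [hΔ]; abel
    have hYT : Y - T = (Y - M) - Δ := by rw [hΔ]; abel
    rw [hYT, hT']
    simp only [Matrix.transpose_sub, Matrix.sub_mul, Matrix.mul_add, Matrix.trace_sub,
      Matrix.trace_add]
    ring
  have h3 := trace_noise_halfMatrix_le hY hskew
  have h4 := (abs_le.1 (abs_trace_transpose_mul_le (Y - M) Δ)).2
  have h5 := (abs_le.1 (abs_trace_transpose_mul_le Δ M)).1
  have h6 := frobSq_nonneg Δ
  rw [hYM] at h4
  rw [hMn] at h5
  have h7 := sqrt_frobSq_triangle M T 0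
  rw [sub_zero, sub_zero, hMn, sqrt_frobSq_sub_comm] at h7
  have h8 : t * (n / 2 - e) ≤ t * √(frobSq T) := by
    gcongr
    linarith
  have h9 : t * (n / 2 - e) ≤ n / 4 + n * e := by linarith
  by_contra! hlt
  nlinarith [mul_nonneg ht (sub_nonneg.2 hn'), mul_nonneg (sub_nonneg.2 ht') (sub_nonneg.2 hn')]

end LowerBound

/-! ### Singular values of a total order via tent functions. -/

section Tent

open Matrix Module

variable {n m q : ℕ}

theorem sum_range_mul_eq (F : ℕ → ℝ) (m L : ℕ) :
    ∑ i ∈ Finset.range (m * L), F i =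
      ∑ k ∈ Finset.range m, ∑ p ∈ Finset.range L, F (k * L + p) := by
  induction m with
  | zero => simp
  | succ m ih => rw [Nat.succ_mul, Finset.sum_range_add, ih, Finset.sum_range_succ]

/-- The tent function of width `4 q` on the integers. -/
noncomputable def tent (q p : ℕ) : ℝ := min (p : ℝ) (4 * q - p)

theorem abs_tent_succ_sub_le (q p : ℕ) : |tent q (p + 1) - tent q p| ≤ 1 := by
  simp only [tent, Nat.cast_add, Nat.cast_one]
  rw [abs_le]
  rcases le_total (p : ℝ) (4 * q - p) with h | h <;>
    rcases le_total ((p : ℝ) + 1) (4 * q - (p + 1)) with h' | h' <;>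
    simp only [h, h', min_eq_left, min_eq_right] <;> constructor <;> linarith

theorem le_sum_tent_sq (q : ℕ) : 2 * (q : ℝ) ^ 3 ≤ ∑ p ∈ Finset.range (4 * q), tent q p ^ 2 := by
  -- On the middle half of its support the tent has height at least `q`.
  have hsub : Finset.Ico q (3 * q) ⊆ Finset.range (4 * q) := fun p hp => by
    rw [Finset.mem_Ico] at hp
    rw [Finset.mem_range]
    omega
  refine le_trans ?_ (Finset.sum_le_sum_of_subset_of_nonneg hsub fun _ _ _ => sq_nonneg _)
  refine le_trans ?_ (Finset.card_nsmul_le_sum _ _ ((q : ℝ) ^ 2) fun p hp => ?_)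
  · rw [Nat.card_Ico, nsmul_eq_mul, show 3 * q - q = 2 * q by omega]
    push_cast
    exact le_of_eq (by ring)
  · rw [Finset.mem_Ico] at hp
    have h1 : (q : ℝ) ≤ p := by exact_mod_cast hp.1
    have h2 : (p : ℝ) ≤ 3 * q := by exact_mod_cast hp.2.le
    gcongr
    exact le_min h1 (by linarith)

/-- A sequence supported on the first `m` natural numbers. -/
noncomputable def extend (a : Fin m → ℝ) (k : ℕ) : ℝ := if h : k < m then a ⟨k, h⟩ else 0

theorem sum_extend_sq (a : Fin m → ℝ) : ∑ k ∈ Finset.range m, extend a k ^ 2 = ∑ k, a k ^ 2 := by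
  rw [← Fin.sum_univ_eq_sum_range (fun k => extend a k ^ 2)]
  exact Finset.sum_congr rfl fun k _ => by simp [extend]

/-- The concatenation of `m` tents of width `4 q` with heights scaled by `a`. -/
noncomputable def tents (q : ℕ) (a : Fin m → ℝ) (i : ℕ) : ℝ :=
  extend a (i / (4 * q)) * tent q (i % (4 * q))

theorem tents_eq_zero (hq : 0 < q) (a : Fin m → ℝ) {i : ℕ} (hi : m * (4 * q) ≤ i) :
    tents q a i = 0 := by
  have : ¬ i / (4 * q) < m := by
    rw [not_lt, Nat.le_div_iff_mul_le (by omega)]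
    exact hi
  simp [tents, extend, this]

/-- The endpoint `p = 4 * q` is allowed because the tent vanishes at both ends; increments across
block boundaries thus need no separate treatment. -/
theorem tents_block (hq : 0 < q) (a : Fin m → ℝ) (k : ℕ) {p : ℕ} (hp : p ≤ 4 * q) :
    tents q a (k * (4 * q) + p) = extend a k * tent q p := by
  have h0 : 0 < 4 * q := by omega
  rcases hp.lt_or_eq with hp | rfl
  · rw [tents, mul_comm k, Nat.mul_add_div h0, Nat.mul_add_mod, Nat.div_eq_of_lt hp,
      Nat.mod_eq_of_lt hp, add_zero]
  · rw [tents, ← Nat.succ_mul, Nat.mul_mod_left]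
    simp [tent]

theorem tents_sub_sq_le (hq : 0 < q) (a : Fin m → ℝ) (i : ℕ) :
    (tents q a (i + 1) - tents q a i) ^ 2 ≤ extend a (i / (4 * q)) ^ 2 := by
  have h0 : 0 < 4 * q := by omega
  have hlt := Nat.mod_lt i h0
  have hi : i / (4 * q) * (4 * q) + i % (4 * q) = i := by
    rw [mul_comm]; exact Nat.div_add_mod i (4 * q)
  have h1 := tents_block hq a (i / (4 * q)) hlt.le
  have h2 := tents_block hq a (i / (4 * q)) (p := i % (4 * q) + 1) hlt
  rw [← add_assoc, hi] at h2
  rw [hi] at h1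
  rw [h1, h2, ← mul_sub, mul_pow]
  refine mul_le_of_le_one_right (sq_nonneg _) ?_
  rw [sq_le_one_iff_abs_le_one]
  exact abs_tent_succ_sub_le _ _

theorem sum_tents_sub_sq_le (hq : 0 < q) (hm : m * (4 * q) ≤ n) (a : Fin m → ℝ) :
    ∑ i : Fin n, (tents q a (i + 1) - tents q a i) ^ 2 ≤ 4 * q * ∑ k, a k ^ 2 := by
  have h0 : 0 < 4 * q := by omega
  rw [Fin.sum_univ_eq_sum_range fun i => (tents q a (i + 1) - tents q a i) ^ 2]
  refine (Finset.sum_le_sum fun i _ => tents_sub_sq_le hq a i).trans ?_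
  have h1 : ∑ i ∈ Finset.range n, extend a (i / (4 * q)) ^ 2 =
      ∑ i ∈ Finset.range (m * (4 * q)), extend a (i / (4 * q)) ^ 2 := by
    symm
    refine Finset.sum_subset (Finset.range_subset_range.2 hm) fun i _ hi => ?_
    have : ¬ i / (4 * q) < m := by
      rw [not_lt, Nat.le_div_iff_mul_le h0]
      simpa using hi
    simp [extend, this]
  rw [h1, sum_range_mul_eq, ← sum_extend_sq, Finset.mul_sum]
  refine Finset.sum_le_sum fun k _ => ?_
  rw [Finset.sum_congr rfl fun p hp => by
    rw [mul_comm k, Nat.mul_add_div h0, Nat.div_eq_of_lt (Finset.mem_range.1 hp), add_zero]]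
  simp

theorem le_sum_tents_sq (hq : 0 < q) (hm : m * (4 * q) ≤ n) (a : Fin m → ℝ) :
    2 * (q : ℝ) ^ 3 * ∑ k, a k ^ 2 ≤ ∑ i : Fin n, tents q a (i + 1) ^ 2 := by
  rw [Fin.sum_univ_eq_sum_range fun i => tents q a (i + 1) ^ 2]
  have h1 : ∑ i ∈ Finset.range n, tents q a (i + 1) ^ 2 =
      ∑ i ∈ Finset.range (n + 1), tents q a i ^ 2 := by
    rw [Finset.sum_range_succ']
    simp [tents, tent]
  rw [h1]
  refine le_trans ?_ (Finset.sum_le_sum_of_subset_of_nonneg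
    (Finset.range_subset_range.2 (hm.trans n.le_succ)) fun _ _ _ => sq_nonneg _)
  rw [sum_range_mul_eq, ← sum_extend_sq, Finset.mul_sum]
  refine Finset.sum_le_sum fun k _ => ?_
  rw [Finset.sum_congr rfl fun p hp => by
    rw [tents_block hq a k (Finset.mem_range.1 hp).le, mul_pow], ← Finset.mul_sum, mul_comm]
  gcongr
  exact le_sum_tent_sq q

/-- The increments of the tents, as a linear function of their heights. -/
noncomputable def tentIncrements (n q m : ℕ) : (Fin m → ℝ) →ₗ[ℝ] EuclideanSpace ℝ (Fin n) where
  toFun a := WithLp.toLp 2 fun i => tents q a (i + 1) - tents q a i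
  map_add' a b := by
    have h : ∀ k, extend (a + b) k = extend a k + extend b k := fun k => by
      unfold extend; split_ifs <;> simp
    ext i
    simp only [tents, h, PiLp.add_apply]
    ring
  map_smul' c a := by
    have h : ∀ k, extend (c • a) k = c * extend a k := fun k => by
      unfold extend; split_ifs <;> simp
    ext i
    simp only [tents, h, PiLp.smul_apply, smul_eq_mul, RingHom.id_apply]
    ring

/-- `Y` is a `0`/`1` comparison matrix of the total order on the items, with arbitrary diagonal. -/
def IsTotalOrder (Y : Matrix (Fin n) (Fin n) ℝ) : Prop :=
  (∀ i j, i < j → Y i j = 1) ∧ (∀ i j, j < i → Y i j = 0) ∧ ∀ i, Y i i = 0 ∨ Y i i = 1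

theorem sum_increments_above (f : ℕ → ℝ) {i : ℕ} (hi : i < n) :
    ∑ j : Fin n, (if i < j.1 then f (j + 1) - f j else 0) = f n - f (i + 1) := by
  rw [Fin.sum_univ_eq_sum_range fun j => if i < j then f (j + 1) - f j else 0]
  -- Clamping indices from below at `i + 1` turns the restricted sum into a full telescoping one.
  have h : ∀ j, (if i < j then f (j + 1) - f j else 0) =
      f (max (j + 1) (i + 1)) - f (max j (i + 1)) := by
    intro j
    split_ifs with hj
    · rw [max_eq_left (by omega), max_eq_left (by omega)]
    · rw [max_eq_right (by omega), max_eq_right (by omega), sub_self]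
  rw [Finset.sum_congr rfl fun j _ => h j, Finset.sum_range_sub fun j => f (max j (i + 1)),
    max_eq_left (by omega), max_eq_right (by omega)]

/-- Up to its diagonal, `Y` sums the later entries, so it integrates the increments back to minus
the tents, which vanish at `n`. -/
theorem IsTotalOrder.apply_tentIncrements {Y : Matrix (Fin n) (Fin n) ℝ} (hY : IsTotalOrder Y)
    (hq : 0 < q) (hm : m * (4 * q) ≤ n) (a : Fin m → ℝ) (i : Fin n) :
    toEuclideanLin Y (tentIncrements n q m a) i =
      Y i i * tentIncrements n q m a i - tents q a (i + 1) := by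
  set x := tentIncrements n q m a with hx
  have hxj : ∀ j : Fin n, x j = tents q a (j + 1) - tents q a j := fun j => rfl
  have h1 : toEuclideanLin Y x i = ∑ j, Y i j * x j := rfl
  have h2 : ∀ j, Y i j * x j = (if j = i then Y i i * x i else 0) +
      (if i.1 < j.1 then tents q a (j + 1) - tents q a j else 0) := by
    intro j
    rcases lt_trichotomy i j with h | h | h
    · rw [hY.1 i j h, if_neg h.ne', if_pos (show i.1 < j.1 from h), hxj]; ring
    · subst h; simp
    · rw [hY.2.1 i j h, if_neg h.ne, if_neg (show ¬ i.1 < j.1 from not_lt.2 (le_of_lt h))]; ring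
  rw [h1, Finset.sum_congr rfl fun j _ => h2 j, Finset.sum_add_distrib,
    sum_increments_above (tents q a) i.2, tents_eq_zero hq a hm]
  simp
  ring

/-- A total order comparison matrix has at least `m` singular values that are at least `q / 4`. -/
theorem IsTotalOrder.le_card_singularValues {Y U V : Matrix (Fin n) (Fin n) ℝ} {d : Fin n → ℝ}
    (hY : IsTotalOrder Y) (h : IsSVD Y U d V) (hq : 3 ≤ q) (hm : m * (4 * q) ≤ n) :
    m ≤ (Finset.univ.filter fun j => (q : ℝ) / 4 ≤ d j).card := by
  classical
  have hU : Uᵀ * U = 1 := (Matrix.mem_orthogonalGroup_iff' _ _).1 h.left_orthogonal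
  have hV : V * Vᵀ = 1 := (Matrix.mem_orthogonalGroup_iff _ _).1 h.right_orthogonal
  set J : Finset (Fin n) := Finset.univ.filter fun j => (q : ℝ) / 4 ≤ d j with hJ
  by_contra! hlt
  let ψ : (Fin m → ℝ) →ₗ[ℝ] J → ℝ :=
    LinearMap.funLeft ℝ ℝ (Subtype.val : J → Fin n) ∘ₗ
      (WithLp.linearEquiv 2 ℝ (Fin n → ℝ)).toLinearMap ∘ₗ toEuclideanLin Vᵀ ∘ₗ
        tentIncrements n q m
  -- Fewer than `m` large singular values would leave nonzero heights `a` whose increments avoid all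
  -- the corresponding right singular vectors.
  have hker : LinearMap.ker ψ ≠ ⊥ := LinearMap.ker_ne_bot_of_finrank_lt (by simpa using hlt)
  obtain ⟨a, ha, ha0⟩ := Submodule.exists_mem_ne_zero_of_ne_bot hker
  set x := tentIncrements n q m a with hx
  have hcoord : ∀ j ∈ J, toEuclideanLin Vᵀ x j = 0 := fun j hj =>
    congrFun (LinearMap.mem_ker.1 ha) ⟨j, hj⟩
  have hup : ‖toEuclideanLin Y x‖ ≤ q / 4 * ‖x‖ := by
    rw [h.eq_mul]
    refine norm_orthogonal_diagonal_le hU hV (by positivity) x fun j hj => ?_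
    rw [abs_of_nonneg (h.nonneg j)]
    by_contra! hgt
    exact hj (hcoord j (by simp [hJ, hgt.le]))
  set y : EuclideanSpace ℝ (Fin n) := WithLp.toLp 2 fun i => tents q a (i + 1) with hy
  set z : EuclideanSpace ℝ (Fin n) := WithLp.toLp 2 fun i => Y i i * x i with hz
  have hq0 : 0 < q := by omega
  have hzx : ‖z‖ ≤ ‖x‖ := by
    refine le_of_sq_le_sq ?_ (norm_nonneg _)
    rw [EuclideanSpace.real_norm_sq_eq, EuclideanSpace.real_norm_sq_eq]
    refine Finset.sum_le_sum fun i _ => ?_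
    change (Y i i * x i) ^ 2 ≤ x i ^ 2
    rcases hY.2.2 i with h | h <;> rw [h]
    · rw [zero_mul, zero_pow two_ne_zero]; exact sq_nonneg _
    · rw [one_mul]
  have hYx : y = z - toEuclideanLin Y x := by
    ext i
    rw [PiLp.sub_apply, hY.apply_tentIncrements hq0 hm a i]
    change _ = Y i i * x i - (Y i i * x i - _)
    rw [sub_sub_cancel]
  have hyx : ‖y‖ ≤ (1 + q / 4) * ‖x‖ := by
    rw [hYx]
    refine (norm_sub_le _ _).trans ?_
    linarith
  have hA : 0 < ∑ k, a k ^ 2 := by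
    obtain ⟨k, hk⟩ := Function.ne_iff.1 ha0
    have hk' : a k ≠ 0 := hk
    exact Finset.sum_pos' (fun _ _ => sq_nonneg _) ⟨k, Finset.mem_univ _, by positivity⟩
  have h1 : ‖x‖ ^ 2 ≤ 4 * q * ∑ k, a k ^ 2 := by
    rw [EuclideanSpace.real_norm_sq_eq]
    exact sum_tents_sub_sq_le hq0 hm a
  have h2 : 2 * (q : ℝ) ^ 3 * ∑ k, a k ^ 2 ≤ ‖y‖ ^ 2 := by
    rw [EuclideanSpace.real_norm_sq_eq]
    exact le_sum_tents_sq hq0 hm a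
  have h3 : ‖y‖ ^ 2 ≤ (1 + q / 4) ^ 2 * (4 * q * ∑ k, a k ^ 2) := by
    calc ‖y‖ ^ 2 ≤ ((1 + q / 4) * ‖x‖) ^ 2 := by gcongr
      _ = (1 + q / 4) ^ 2 * ‖x‖ ^ 2 := mul_pow _ _ _
      _ ≤ _ := by gcongr
  -- Tents are long compared with their increments, by a factor of order `q`; this inequality fails
  -- as soon as `q ≥ 3`.
  have h4 : 2 * (q : ℝ) ^ 3 ≤ (1 + q / 4) ^ 2 * (4 * q) := by
    refine le_of_mul_le_mul_right (h2.trans (h3.trans_eq ?_)) hA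
    ring
  have hq3 : (3 : ℝ) ≤ q := by exact_mod_cast hq
  have h5 : 2 * (q : ℝ) ^ 2 ≤ (1 + q / 4) ^ 2 * 4 := by
    refine le_of_mul_le_mul_right ?_ (show (0 : ℝ) < q by linarith)
    linarith
  nlinarith

theorem IsTotalOrder.le_frobSq_sub_softSVT {Y : Matrix (Fin n) (Fin n) ℝ} (hY : IsTotalOrder Y)
    (hq : 3 ≤ q) (hm : m * (4 * q) ≤ n) {t : ℝ} (ht : (q : ℝ) / 4 ≤ t) :
    m * ((q : ℝ) / 4) ^ 2 ≤ frobSq (Y - softSVT t Y) := by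
  obtain ⟨U, d, V, h⟩ := exists_isSVD Y
  have hU : Uᵀ * U = 1 := (Matrix.mem_orthogonalGroup_iff' _ _).1 h.left_orthogonal
  have hV : Vᵀ * V = 1 := (Matrix.mem_orthogonalGroup_iff' _ _).1 h.right_orthogonal
  have ht0 : 0 ≤ t := le_trans (by positivity) ht
  rw [sub_softSVT_eq ht0 h, frobSq_orthogonal_diagonal hU hV]
  have hcard := hY.le_card_singularValues h hq hm
  calc m * ((q : ℝ) / 4) ^ 2
      ≤ (Finset.univ.filter fun j => (q : ℝ) / 4 ≤ d j).card * ((q : ℝ) / 4) ^ 2 := by gcongr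
    _ ≤ ∑ j ∈ Finset.univ.filter fun j => (q : ℝ) / 4 ≤ d j, (d - softThreshold t d) j ^ 2 := by
      rw [← nsmul_eq_mul]
      refine Finset.card_nsmul_le_sum _ _ _ fun j hj => ?_
      have hj' : (q : ℝ) / 4 ≤ d j := by simpa using hj
      gcongr
      simp only [Pi.sub_apply, softThreshold]
      rcases le_total (d j - t) 0 with h | h
      · rw [max_eq_left h]; linarith
      · rw [max_eq_right h]; linarith
    _ ≤ _ := Finset.sum_le_sum_of_subset_of_nonneg (Finset.subset_univ _) fun _ _ _ => sq_nonneg _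

/-- The SST matrix of the noiseless total order. -/
noncomputable def orderMatrix (n : ℕ) : Matrix (Fin n) (Fin n) ℝ :=
  Matrix.of fun i j => if i < j then 1 else if i = j then 1 / 2 else 0

theorem orderMatrix_mem_SST : orderMatrix n ∈ SST n := by
  refine ⟨fun i j => ?_, fun i j => ?_, 1, fun i j hij k => ?_⟩
  · simp only [orderMatrix, Matrix.of_apply]
    split_ifs <;> norm_num
  · simp only [orderMatrix, Matrix.of_apply]
    rcases lt_trichotomy i j with h | h | h
    · simp [h, h.not_gt, h.ne']
    · subst h; norm_num
    · simp [h, h.not_gt, h.ne']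
  · have hij' : i < j := hij
    simp only [orderMatrix, Matrix.of_apply]
    rcases lt_trichotomy j k with h | h | h
    · simp [h, hij'.trans h]
    · subst h; simp [hij']; norm_num
    · rw [if_neg h.not_gt, if_neg h.ne']
      split_ifs <;> norm_num

theorem IsTotalOrder.frobSq_sub_orderMatrix {Y : Matrix (Fin n) (Fin n) ℝ}
    (hY : IsTotalOrder Y) : frobSq (Y - orderMatrix n) = n / 4 := by
  have h : ∀ i, ∑ j, (Y - orderMatrix n) i j ^ 2 = 1 / 4 := by
    intro i
    rw [Finset.sum_eq_single i]
    · simp only [Matrix.sub_apply, orderMatrix, Matrix.of_apply, lt_irrefl, if_false, if_true]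
      rcases hY.2.2 i with h | h <;> rw [h] <;> norm_num
    · intro j _ hj
      simp only [Matrix.sub_apply, orderMatrix, Matrix.of_apply]
      rcases lt_or_gt_of_ne hj with h | h
      · simp [hY.2.1 i j h, h.not_gt, hj.symm]
      · simp [hY.1 i j h, h]
    · simp
  rw [frobSq, Finset.sum_congr rfl fun i _ => h i]
  simp
  ring

/-- Thresholding at a high level removes too much of a total order. -/
theorem IsTotalOrder.le_frobSq_softSVT_sub {Y : Matrix (Fin n) (Fin n) ℝ} (hY : IsTotalOrder Y)
    (hn : 10000 ≤ n) {t : ℝ} (ht : 9 / 20 * √(n : ℝ) ≤ t) :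
    1 / 1000 * (n * √(n : ℝ)) ≤ frobSq (softSVT t Y - orderMatrix n) := by
  set q := Nat.sqrt n with hq
  have hqn : q * q ≤ n := Nat.sqrt_le n
  have hnq : n < (q + 1) * (q + 1) := Nat.lt_succ_sqrt n
  have hq100 : 100 ≤ q := by
    rw [hq, Nat.le_sqrt]
    omega
  have hs1 : (q : ℝ) ≤ √(n : ℝ) := by
    refine Real.le_sqrt_of_sq_le ?_
    rw [sq]
    exact_mod_cast hqn
  have hs2 : √(n : ℝ) ≤ q + 1 := by
    refine Real.sqrt_le_iff.2 ⟨by positivity, ?_⟩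
    rw [sq]
    exact_mod_cast hnq.le
  have hm : q / 4 * (4 * q) ≤ n := by
    have : q / 4 * 4 ≤ q := Nat.div_mul_le_self q 4
    nlinarith
  have hS := hY.le_frobSq_sub_softSVT (q := q) (m := q / 4) (by omega) hm (t := t)
    (by linarith [Nat.cast_nonneg (α := ℝ) q])
  have hq100' : (100 : ℝ) ≤ q := by exact_mod_cast hq100
  have hm' : ((q : ℝ) - 3) / 4 ≤ ((q / 4 : ℕ) : ℝ) := by
    have : q ≤ 4 * (q / 4) + 3 := by omega
    have : (q : ℝ) ≤ 4 * ((q / 4 : ℕ) : ℝ) + 3 := by exact_mod_cast this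
    linarith
  have hnq' : (n : ℝ) ≤ (q + 1) * (q + 1) := by exact_mod_cast hnq.le
  set S := frobSq (Y - softSVT t Y) with hSdef
  have hS1 : ((q : ℝ) - 3) / 4 * (q / 4) ^ 2 ≤ S := le_trans (by gcongr) hS
  -- `S` is of order `q³`; once `S ≥ n`, the distance `√n / 2` from `Y` to `orderMatrix n` uses up
  -- at most half of `√S`.
  have hS2 : (n : ℝ) ≤ S := by nlinarith [mul_nonneg (sub_nonneg.2 hq100') (sq_nonneg (q : ℝ))]
  have h1 := sqrt_frobSq_triangle Y (orderMatrix n) (softSVT t Y)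
  rw [← hSdef, hY.frobSq_sub_orderMatrix, sqrt_frobSq_sub_comm (orderMatrix n)] at h1
  have h2 : √((n : ℝ) / 4) ≤ √S / 2 := by
    rw [Real.sqrt_le_left (by positivity), div_pow, Real.sq_sqrt (frobSq_nonneg _)]
    linarith
  have h3 : √S / 2 ≤ √(frobSq (softSVT t Y - orderMatrix n)) := by linarith
  have h4 : S / 4 ≤ frobSq (softSVT t Y - orderMatrix n) := by
    have := pow_le_pow_left₀ (by positivity) h3 2
    rw [div_pow, Real.sq_sqrt (frobSq_nonneg _), Real.sq_sqrt (frobSq_nonneg _)] at this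
    linarith
  have h5 : (n : ℝ) * √(n : ℝ) ≤ (q + 1) * (q + 1) * (q + 1) := by gcongr
  have h6 : ((q : ℝ) + 1) * (q + 1) * (q + 1) ≤ 11 / 10 * (q : ℝ) ^ 3 := by
    nlinarith [mul_nonneg (sub_nonneg.2 hq100') (sq_nonneg (q : ℝ)),
      mul_nonneg (sub_nonneg.2 hq100') (sub_nonneg.2 hq100')]
  nlinarith [mul_nonneg (sub_nonneg.2 hq100') (sq_nonneg (q : ℝ))]

end Tent

/-! ### Almost sure lower bound and conclusion. -/

section AlmostSure

variable {n : ℕ} {Ω : Type*} [MeasurableSpace Ω] {μ : Measure Ω} [IsProbabilityMeasure μ]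
  {Y : Ω → Matrix (Fin n) (Fin n) ℝ}

theorem IsObservation.ae_isTotalOrder (h : IsObservation (orderMatrix n) Y μ) :
    ∀ᵐ ω ∂μ, IsTotalOrder (Y ω) := by
  have h1 : ∀ᵐ ω ∂μ, ∀ i j, i < j → Y ω i j = 1 := by
    rw [ae_all_iff]
    intro i
    rw [ae_all_iff]
    intro j
    by_cases hij : i < j
    · have hp := h.prob_eq i j hij.le
      have hms : MeasurableSet {ω | Y ω i j = 1} := h.measurable i j (measurableSet_singleton 1)
      have : μ {ω | Y ω i j = 1} = 1 := by
        rw [← ofReal_measureReal, hp]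
        simp [orderMatrix, hij]
      have hmem : {ω | Y ω i j = 1} ∈ ae μ := (mem_ae_iff_prob_eq_one hms).2 this
      filter_upwards [hmem] with ω hω _ using hω
    · exact Filter.Eventually.of_forall fun ω hlt => absurd hlt hij
  filter_upwards [h1] with ω hω
  refine ⟨hω, fun i j hij => ?_, fun i => h.zero_or_one ω i i⟩
  rw [h.skew ω j i hij, hω j i hij, sub_self]

end AlmostSure

theorem div_sqrt_le_normalizedError {n : ℕ} (hn : 2 ≤ n) {c : ℝ}
    {A M : Matrix (Fin n) (Fin n) ℝ} (h : c * (n * √(n : ℝ)) ≤ frobSq (A - M)) :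
    c / √(n : ℝ) ≤ normalizedError A M := by
  have hn0 : (0 : ℝ) < n := by exact_mod_cast (by omega : 0 < n)
  have hs : 0 < √(n : ℝ) := Real.sqrt_pos.2 hn0
  have hss : √(n : ℝ) * √(n : ℝ) = n := Real.mul_self_sqrt hn0.le
  rw [normalizedError_eq, div_le_div_iff₀ hs (by positivity)]
  calc c * (n : ℝ) ^ 2 = c * (n * √(n : ℝ)) * √(n : ℝ) := by
        linear_combination (-c * n) * hss
    _ ≤ _ := by gcongr

/-- Three regimes: small threshold, large threshold with `n ≤ 10000`, and large threshold with
larger `n`. The middle one fixes the tiny constant, since there the squared error is only known to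
be at least `(3 / 100)²` while `n √n` is bounded by `10 ^ 8`. -/
theorem exists_SST_normalizedError_ge {n : ℕ} (hn : 2 ≤ n) {t : ℝ} (ht : 0 < t) :
    ∃ M ∈ SST n, ∀ (Ω : Type*) [MeasurableSpace Ω] (μ : Measure Ω) [IsProbabilityMeasure μ]
      (Y : Ω → Matrix (Fin n) (Fin n) ℝ), IsObservation M Y μ →
        ∀ᵐ ω ∂μ, (1 / 10 ^ 12) / √(n : ℝ) ≤ normalizedError (softSVT t (Y ω)) M := by
  have hn' : (2 : ℝ) ≤ n := by exact_mod_cast hn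
  have hs0 : 0 ≤ √(n : ℝ) := Real.sqrt_nonneg _
  have hsn : √(n : ℝ) ≤ n := by
    refine Real.sqrt_le_iff.2 ⟨by positivity, ?_⟩
    nlinarith
  have hsq : ∀ {c : ℝ} {A B : Matrix (Fin n) (Fin n) ℝ}, 0 ≤ c → c ≤ √(frobSq (A - B)) →
      c ^ 2 ≤ frobSq (A - B) := fun hc h => by
    have := pow_le_pow_left₀ hc h 2
    rwa [Real.sq_sqrt (frobSq_nonneg _)] at this
  have hnsn : (n : ℝ) * √(n : ℝ) ≤ n * n := by gcongr
  rcases le_total t (9 / 20 * √(n : ℝ)) with hle | hge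
  · refine ⟨halfMatrix n, halfMatrix_mem_SST, fun Ω _ μ _ Y h => Filter.Eventually.of_forall
      fun ω => div_sqrt_le_normalizedError hn ?_⟩
    have := hsq (by positivity) (le_sqrt_frobSq_of_small_threshold ht.le hle (h.zero_or_one ω))
    nlinarith
  rcases le_or_gt n 10000 with hsmall | hlarge
  · refine ⟨halfMatrix n, halfMatrix_mem_SST, fun Ω _ μ _ Y h => Filter.Eventually.of_forall
      fun ω => div_sqrt_le_normalizedError hn ?_⟩
    have := hsq (by norm_num)
      (le_sqrt_frobSq_of_large_threshold hn hge (h.zero_or_one ω) (h.skew ω))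
    have h4 : (n : ℝ) ≤ 10000 := by exact_mod_cast hsmall
    have h5 : (n : ℝ) * n ≤ 10000 * 10000 := by gcongr
    refine le_trans ?_ this
    linarith
  · refine ⟨orderMatrix n, orderMatrix_mem_SST, fun Ω _ μ _ Y h => ?_⟩
    filter_upwards [h.ae_isTotalOrder] with ω hω
    refine div_sqrt_le_normalizedError hn (le_trans ?_ (hω.le_frobSq_softSVT_sub hlarge.le hge))
    gcongr
    norm_num

end PairwiseComparison

theorem theorem2 :
    (∃ c_u c₀ c₁ : ℝ, 0 < c_u ∧ 0 < c₀ ∧ 0 < c₁ ∧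
      ∀ n : ℕ, 2 ≤ n → ∀ M ∈ PairwiseComparison.SST n,
        ∀ (Ω : Type*) [MeasurableSpace Ω] (μ : Measure Ω) [IsProbabilityMeasure μ]
          (Y : Ω → Matrix (Fin n) (Fin n) ℝ), PairwiseComparison.IsObservation M Y μ →
          μ.real {ω | c_u / √(n : ℝ) ≤ PairwiseComparison.normalizedError
              (PairwiseComparison.softSVT (2.1 * √(n : ℝ)) (Y ω)) M}
            ≤ c₀ * Real.exp (-c₁ * n)) ∧
    (∃ c_l : ℝ, 0 < c_l ∧
      ∀ n : ℕ, 2 ≤ n → ∀ t : ℝ, 0 < t → ∃ M ∈ PairwiseComparison.SST n,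
        ∀ (Ω : Type*) [MeasurableSpace Ω] (μ : Measure Ω) [IsProbabilityMeasure μ]
          (Y : Ω → Matrix (Fin n) (Fin n) ℝ), PairwiseComparison.IsObservation M Y μ →
          ∀ᵐ ω ∂μ, c_l / √(n : ℝ) ≤ PairwiseComparison.normalizedError
            (PairwiseComparison.softSVT t (Y ω)) M) := by
  refine ⟨⟨10000, Real.exp 80, 4 / 5, by norm_num, Real.exp_pos _, by norm_num, ?_⟩,
    1 / 10 ^ 12, by norm_num, ?_⟩
  · intro n hn M hM Ω _ μ _ Y hY
    exact hY.measure_normalizedError_ge_le hM hn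
  · intro n hn t ht
    exact PairwiseComparison.exists_SST_normalizedError_ge hn ht
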